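/- Let $p\ge q\ge 0$ be integers, let $F$ be a constant real $p\times q$ matrix, let $c\in\mathbb C$, and let $E$ be the $p\times q$ matrix $E_{ij}=\delta_{ij}$. The phase space is $T^*SO(p)$, with points $(k,\ell)$, $k\in SO(p)$, $\ell\in so(p)$ (left trivialization), and with its canonical Poisson bracket $$\{\ell_{ij},\ell_{mn}\}=\delta_{in}\ell_{jm}+\delta_{jm}\ell_{in}-\delta_{im}\ell_{jn}-\delta_{jn}\ell_{im},\qquad \{\ell_{ij},k_{nm}\}=\delta_{jm}k_{ni}-\delta_{im}k_{nj},\qquad \{k_{ij},k_{mn}\}=0 .$$ In $(p,q)$-block notation put $$\tilde a=\begin{pmatrix}0&E\\E^T&0\end{pmatrix},\qquad \tilde s=\begin{pmatrix}0&k^TF\\F^Tk&0\end{pmatrix},\qquad \tilde z=c\begin{pmatrix}0&E\\-E^T&0\end{pmatrix}.$$ The Kowalevski reduction in the body frame ($r=1$, $m=-E^T\ell E$, $A=E$) gives the Lax matrices $$\widetilde L^{Kow}(\lambda)=\lambda\,\tilde a-\begin{pmatrix}\ell&0\\0&-E^T\ell E\end{pmatrix}+\lambda^{-1}\tilde s,\qquad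 \widetilde L_z(\lambda)=(1-\lambda\tilde z)^{-1}\Bigl(\widetilde L^{Kow}(\lambda)-\tfrac12(\tilde z\tilde s+\tilde s\tilde z)\Bigr),$$ for complex $\lambda\neq0$ and, in the case of $\widetilde L_z$, $\det(1-\lambda\tilde z)\ne0$. Let $Z_\alpha$ run over the matrices $e_{ij}-e_{ji}$, $i<j$, of the first (size $p$) and of the second (size $q$) diagonal block, and let $S_\beta$ run over the $pq$ symmetric matrices with one unit in the upper right block and its transpose in the lower left block. Put $P_{\mathfrak f}=\sum_\alpha Z_\alpha\otimes Z_\alpha$, $P_{\mathfrak p}=\sum_\beta S_\beta\otimes S_\beta$, $$r_{12}(\lambda,\mu)=-\frac{\lambda^2}{\lambda^2-\mu^2}P_{\mathfrak f}+\frac{\lambda\mu}{\lambda^2-\mu^2}P_{\mathfrak p},\qquad \widetilde r_{12}(\lambda,\mu)=-r_{12}(\lambda^{-1},\mu^{-1}),$$ $$\widetilde r_{12}^{\,Kow}(\lambda,\mu)=\widetilde r_{12}(\lambda,\mu)-\sum_\alpha Z_\alpha\otimes\widehat PZ_\alpha\widehat P,$$ $$\widetilde r_{12}^{\,zKow}(\lambda,\mu)=\bigl[1\otimes(1-\mu\tilde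 z)^{-1}\bigr]\Bigl(\widetilde r_{12}(\lambda,\mu)\bigl[(1-\lambda\tilde z)\otimes1\bigr]-\sum_\alpha Z_\alpha\otimes\widehat PZ_\alpha\widehat P\Bigr).$$ Here $\widehat PZ_\alpha\widehat P$ denotes the following matrix: for $Z_\alpha$ in the first block with indices $i<j\le q$ it is the generator with the same indices $i<j$ in the second block; for the other $Z_\alpha$ of the first block it is $0$; for $Z_\alpha$ in the second block it is $Z_\alpha$. For a kernel $r_{12}$ write $r_{21}(\lambda,\mu)=\Pi\,r_{12}(\mu,\lambda)\,\Pi$, where $\Pi$ is the permutation operator, $\Pi(X\otimes Y)=(Y\otimes X)\Pi$. Then: 1. The spectral invariants of $\widetilde L^{Kow}$ (the traces of the powers and the coefficients of the characteristic polynomials of the matrices $\widetilde L^{Kow}(\lambda)$, and all polynomials in these, for all admissible values of $\lambda$) are in involution on $T^*SO(p)$. 2. The spectral invariants of the reduced $\widetilde L_z$ are in involution on $T^*SO(p)$. 3. For all admissible $\lambda,\mu$ with $\lambda^2\ne\mu^2$, with $L=\widetilde L^{Kow}$ and $r=\widetilde r^{\,Kow}$, and also with $L=\widetilde L_z$ and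 $r=\widetilde r^{\,zKow}$, one has on all of $T^*SO(p)$ $$\{L_1(\lambda),L_2(\mu)\}=-\bigl([r_{12}(\lambda,\mu),L_1(\lambda)]-[r_{21}(\lambda,\mu),L_2(\mu)]\bigr),\qquad L_1(\lambda)=L(\lambda)\otimes1,\quad L_2(\mu)=1\otimes L(\mu).$$ -/

import Mathlib

open scoped Matrix Kronecker

noncomputable section

namespace KowalevskiTop

/-! ## The phase space `T^*SO(p)` and its canonical Poisson bracket -/

/-- The phase space `T^*SO(p)`, trivialised by left translations: pairs `(k, ℓ)` of a rotation
`k ∈ SO(p)` and a momentum `ℓ ∈ so(p)`. -/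
abbrev Phase (p : ℕ) : Type :=
  Matrix.specialOrthogonalGroup (Fin p) ℝ × LieAlgebra.Orthogonal.so (Fin p) ℝ

variable {p q : ℕ}

/-- The rotation, as a matrix. -/
def rot (x : Phase p) : Matrix (Fin p) (Fin p) ℝ := (x.1 : Matrix (Fin p) (Fin p) ℝ)

/-- The momentum, as a matrix. -/
def mom (x : Phase p) : Matrix (Fin p) (Fin p) ℝ := (x.2 : Matrix (Fin p) (Fin p) ℝ)

/-- The generator `e_{ij} - e_{ji}` of `so(p)`. -/
def gen (i j : Fin p) : LieAlgebra.Orthogonal.so (Fin p) ℝ :=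
  ⟨Matrix.single i j 1 - Matrix.single j i 1, by
    rw [LieAlgebra.Orthogonal.mem_so]; simp⟩

theorem exp_mem_specialOrthogonalGroup (X : LieAlgebra.Orthogonal.so (Fin p) ℝ) :
    NormedSpace.exp (X : Matrix (Fin p) (Fin p) ℝ) ∈
      Matrix.specialOrthogonalGroup (Fin p) ℝ := by
  have key : ∀ Y : Matrix (Fin p) (Fin p) ℝ, Yᵀ = -Y →
      (NormedSpace.exp Y)ᵀ * NormedSpace.exp Y = 1 := by
    intro Y hY
    rw [← Matrix.exp_transpose, hY, ← Matrix.exp_add_of_commute _ _ ((Commute.refl Y).neg_left)]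
    simp
  have hX : (X : Matrix (Fin p) (Fin p) ℝ)ᵀ = -(X : Matrix (Fin p) (Fin p) ℝ) :=
    (LieAlgebra.Orthogonal.mem_so _ _ _).1 X.2
  set Y : Matrix (Fin p) (Fin p) ℝ := (1 / 2 : ℝ) • (X : Matrix (Fin p) (Fin p) ℝ) with hYd
  have hY : Yᵀ = -Y := by rw [hYd, Matrix.transpose_smul, hX, smul_neg]
  have hXY : (X : Matrix (Fin p) (Fin p) ℝ) = Y + Y := by
    rw [hYd, ← add_smul]; norm_num
  rw [Matrix.mem_specialOrthogonalGroup_iff, Matrix.mem_orthogonalGroup_iff']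
  refine ⟨key _ hX, ?_⟩
  rw [hXY, Matrix.exp_add_of_commute _ _ rfl, Matrix.det_mul]
  have h := congrArg Matrix.det (key Y hY)
  rwa [Matrix.det_mul, Matrix.det_transpose, Matrix.det_one] at h

/-- The exponential map `so(p) → SO(p)`. -/
def expSO (X : LieAlgebra.Orthogonal.so (Fin p) ℝ) : Matrix.specialOrthogonalGroup (Fin p) ℝ :=
  ⟨NormedSpace.exp (X : Matrix (Fin p) (Fin p) ℝ), exp_mem_specialOrthogonalGroup X⟩

/-- Derivative of an observable along `X` in the momentum variable. -/
def dMom (X : LieAlgebra.Orthogonal.so (Fin p) ℝ) (f : Phase p → ℂ) (x : Phase p) : ℂ :=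
  deriv (fun t : ℝ => f (x.1, x.2 + t • X)) 0

/-- Derivative of an observable along the left-invariant vector field `k ↦ k X` of `SO(p)`. -/
def dRot (X : LieAlgebra.Orthogonal.so (Fin p) ℝ) (f : Phase p → ℂ) (x : Phase p) : ℂ :=
  deriv (fun t : ℝ => f (x.1 * expSO (t • X), x.2)) 0

/-- The right-hand side of the brackets of the momenta,
`{ℓ_ij, ℓ_mn} = δ_in ℓ_jm + δ_jm ℓ_in - δ_im ℓ_jn - δ_jn ℓ_im`. -/
def structureFun (l : Matrix (Fin p) (Fin p) ℝ) (i j m n : Fin p) : ℝ :=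
  (if i = n then l j m else 0) + (if j = m then l i n else 0)
    - (if i = m then l j n else 0) - (if j = n then l i m else 0)

/-- The canonical Poisson bracket of `T^*SO(p)`. Every unordered pair `{i, j}` occurs twice in the
sums over `i, j`, whence the factors `1/2` and `1/4`. The lemmas `poisson_mom_mom`,
`poisson_mom_rot` and `poisson_rot_rot` below give the brackets of the coordinates. -/
def poisson (f g : Phase p → ℂ) (x : Phase p) : ℂ :=
  (1 / 2) * ∑ i, ∑ j, (dMom (gen i j) f x * dRot (gen i j) g x
      - dRot (gen i j) f x * dMom (gen i j) g x)
    + (1 / 4) * ∑ i, ∑ j, ∑ m, ∑ n,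
      (structureFun (mom x) i j m n : ℂ) * dMom (gen i j) f x * dMom (gen m n) g x

theorem structureFun_swap_left (l : Matrix (Fin p) (Fin p) ℝ) (i j m n : Fin p) :
    structureFun l j i m n = -structureFun l i j m n := by
  unfold structureFun; ring

theorem structureFun_swap_right (l : Matrix (Fin p) (Fin p) ℝ) (i j m n : Fin p) :
    structureFun l i j n m = -structureFun l i j m n := by
  unfold structureFun; ring

theorem sum_mul_delta (h : Fin p → Fin p → ℂ) (i j : Fin p) :
    ∑ a, ∑ b, h a b * ((if a = i ∧ b = j then 1 else 0) - (if b = i ∧ a = j then 1 else 0)) =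
      h i j - h j i := by
  simp [mul_sub, Finset.sum_sub_distrib, ite_and]

theorem dMom_mom (a b i j : Fin p) (x : Phase p) :
    dMom (gen a b) (fun y => (mom y i j : ℂ)) x =
      (if a = i ∧ b = j then 1 else 0) - (if b = i ∧ a = j then 1 else 0) := by
  have h : HasDerivAt (fun t : ℝ => ((mom x i j : ℝ) : ℂ) + (t : ℂ) *
      ((if a = i ∧ b = j then 1 else 0) - (if b = i ∧ a = j then 1 else 0)))
      (1 * ((if a = i ∧ b = j then 1 else 0) - (if b = i ∧ a = j then 1 else 0))) 0 :=
    ((Complex.ofRealCLM.hasDerivAt (x := (0 : ℝ))).mul_const _).const_add _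
  rw [one_mul] at h
  rw [← h.deriv, dMom]
  congr 1
  funext t
  change ((mom x i j + t * (Matrix.single a b (1 : ℝ) i j - Matrix.single b a (1 : ℝ) i j) : ℝ) : ℂ)
    = _
  simp only [Matrix.single_apply]
  push_cast
  split_ifs <;> push_cast <;> ring

theorem dRot_mom (a b i j : Fin p) (x : Phase p) :
    dRot (gen a b) (fun y => (mom y i j : ℂ)) x = 0 := by
  simp [dRot, mom]

theorem dMom_rot (a b i j : Fin p) (x : Phase p) :
    dMom (gen a b) (fun y => (rot y i j : ℂ)) x = 0 := by
  simp [dMom, rot]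

theorem dRot_rot (X : LieAlgebra.Orthogonal.so (Fin p) ℝ) (i j : Fin p) (x : Phase p) :
    dRot X (fun y => (rot y i j : ℂ)) x = ((rot x * (X : Matrix (Fin p) (Fin p) ℝ)) i j : ℝ) := by
  have h1 : HasDerivAt (fun t : ℝ => (rot x * NormedSpace.exp
      (t • (X : Matrix (Fin p) (Fin p) ℝ))) i j)
      ((rot x * (X : Matrix (Fin p) (Fin p) ℝ)) i j) 0 := by
    open scoped Matrix.Norms.Operator in
    have h0 := hasDerivAt_exp_smul_const (𝕂 := ℝ) (X : Matrix (Fin p) (Fin p) ℝ) (0 : ℝ)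
    rw [zero_smul, NormedSpace.exp_zero, one_mul] at h0
    exact (LinearMap.toContinuousLinearMap ((Matrix.entryLinearMap ℝ ℝ i j).comp
      (LinearMap.mulLeft ℝ (rot x)))).hasFDerivAt.comp_hasDerivAt (0 : ℝ) h0
  have h2 := h1.ofReal_comp
  rw [← h2.deriv, dRot]
  rfl

/-- `{ℓ_ij, ℓ_mn} = δ_in ℓ_jm + δ_jm ℓ_in - δ_im ℓ_jn - δ_jn ℓ_im`. -/
theorem poisson_mom_mom (i j m n : Fin p) (x : Phase p) :
    poisson (fun y => (mom y i j : ℂ)) (fun y => (mom y m n : ℂ)) x =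
      (structureFun (mom x) i j m n : ℂ) := by
  have e : ∀ a b : Fin p, ∑ m', ∑ n', (structureFun (mom x) a b m' n' : ℂ)
      * ((if a = i ∧ b = j then 1 else 0) - (if b = i ∧ a = j then 1 else 0))
      * ((if m' = m ∧ n' = n then 1 else 0) - (if n' = m ∧ m' = n then 1 else 0))
      = (2 * (structureFun (mom x) a b m n : ℂ))
        * ((if a = i ∧ b = j then 1 else 0) - (if b = i ∧ a = j then 1 else 0)) := by
    intro a b
    rw [sum_mul_delta (fun m' n' => (structureFun (mom x) a b m' n' : ℂ)
      * ((if a = i ∧ b = j then 1 else 0) - (if b = i ∧ a = j then 1 else 0))),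
      structureFun_swap_right]
    push_cast
    ring
  simp only [poisson, dMom_mom, dRot_mom, e]
  rw [sum_mul_delta (fun a b => 2 * (structureFun (mom x) a b m n : ℂ)), structureFun_swap_left]
  push_cast
  simp only [mul_zero, zero_mul, sub_zero, Finset.sum_const_zero]
  ring

/-- `{ℓ_ij, k_nm} = δ_jm k_ni - δ_im k_nj`. -/
theorem poisson_mom_rot (i j m n : Fin p) (x : Phase p) :
    poisson (fun y => (mom y i j : ℂ)) (fun y => (rot y n m : ℂ)) x =
      (if j = m then (rot x n i : ℂ) else 0) - (if i = m then (rot x n j : ℂ) else 0) := by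
  have e : ∀ a b : Fin p, dRot (gen a b) (fun y => (rot y n m : ℂ)) x =
      (if b = m then (rot x n a : ℂ) else 0) - (if a = m then (rot x n b : ℂ) else 0) := by
    intro a b
    have hg : ((gen a b : LieAlgebra.Orthogonal.so (Fin p) ℝ) : Matrix (Fin p) (Fin p) ℝ) =
      Matrix.single a b 1 - Matrix.single b a 1 := rfl
    rw [dRot_rot, hg, Matrix.mul_sub, Matrix.sub_apply]
    simp only [Matrix.mul_apply, Matrix.single_apply, ite_and, mul_ite, mul_one, mul_zero,
      Finset.sum_ite_eq, Finset.mem_univ, if_true]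
    split_ifs <;> simp
  simp only [poisson, dMom_mom, dRot_mom, dMom_rot, mul_zero, sub_zero,
    Finset.sum_const_zero, add_zero]
  simp only [mul_comm _ (dRot _ _ _)]
  rw [sum_mul_delta (fun a b => dRot (gen a b) (fun y => (rot y n m : ℂ)) x), e, e]
  ring

/-- The entries of `k` commute with each other. -/
theorem poisson_rot_rot (i j m n : Fin p) (x : Phase p) :
    poisson (fun y => (rot y i j : ℂ)) (fun y => (rot y m n : ℂ)) x = 0 := by
  simp [poisson, dMom_rot]

/-! ## The Lax matrices -/

/-- Square matrices of size `p + q`, in `(p, q)`-block form. -/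
abbrev BlockMatrix (p q : ℕ) : Type := Matrix (Fin p ⊕ Fin q) (Fin p ⊕ Fin q) ℂ

/-- Real matrices regarded as complex ones. -/
def cx {m n : Type} (M : Matrix m n ℝ) : Matrix m n ℂ := M.map (fun t : ℝ => (t : ℂ))

/-- The symmetric block matrix with off-diagonal blocks `s` and `sᵀ`. -/
def symBlock (s : Matrix (Fin p) (Fin q) ℝ) : BlockMatrix p q :=
  Matrix.fromBlocks 0 (cx s) (cx sᵀ) 0

/-- The matrix `z̃ = c (0, A; -Aᵀ, 0)`. -/
def zTilde (c : ℂ) (A : Matrix (Fin p) (Fin q) ℝ) : BlockMatrix p q :=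
  c • Matrix.fromBlocks 0 (cx A) (-cx Aᵀ) 0

/-- The Lax matrix of the two interacting tops in the body frame,
`L̃(λ) = λ (0, A; Aᵀ, 0) - (ℓ, 0; 0, m) + λ⁻¹ (0, kᵀFr; rᵀFᵀk, 0)`. -/
def laxBody (A F : Matrix (Fin p) (Fin q) ℝ) (k l : Matrix (Fin p) (Fin p) ℝ)
    (r m : Matrix (Fin q) (Fin q) ℝ) (lam : ℂ) : BlockMatrix p q :=
  lam • symBlock A - Matrix.fromBlocks (cx l) 0 0 (cx m) + lam⁻¹ • symBlock (kᵀ * F * r)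

/-- The perturbed Lax matrix in the body frame,
`L̃_z(λ) = (1 - λ z̃)⁻¹ (L̃(λ) - (z̃ s̃ + s̃ z̃) / 2)`, with `s̃` the coefficient of `λ⁻¹` in `L̃`. -/
def laxBodyZ (c : ℂ) (A F : Matrix (Fin p) (Fin q) ℝ) (k l : Matrix (Fin p) (Fin p) ℝ)
    (r m : Matrix (Fin q) (Fin q) ℝ) (lam : ℂ) : BlockMatrix p q :=
  (1 - lam • zTilde c A)⁻¹ * (laxBody A F k l r m lam
    - (1 / 2 : ℂ) • (zTilde c A * symBlock (kᵀ * F * r) + symBlock (kᵀ * F * r) * zTilde c A))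

/-- The truncated identity matrix `E_ij = δ_ij` of size `p × q`. -/
def truncId (p q : ℕ) : Matrix (Fin p) (Fin q) ℝ :=
  Matrix.of fun i j => if (i : ℕ) = (j : ℕ) then 1 else 0

/-- The reduced Lax matrix `L̃^Kow(λ)` on `T^*SO(p)`: `L̃(λ)` with `A = E`, under the constraints
`r = 1` and `m = -Eᵀ ℓ E`. -/
def laxKow (F : Matrix (Fin p) (Fin q) ℝ) (lam : ℂ) (x : Phase p) : BlockMatrix p q :=
  laxBody (truncId p q) F (rot x) (mom x) 1 (-((truncId p q)ᵀ * mom x * truncId p q)) lam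

/-- The reduced perturbed Lax matrix: `L̃_z(λ)` with `A = E`, under the same constraints. -/
def laxKowZ (c : ℂ) (F : Matrix (Fin p) (Fin q) ℝ) (lam : ℂ) (x : Phase p) : BlockMatrix p q :=
  laxBodyZ c (truncId p q) F (rot x) (mom x) 1 (-((truncId p q)ᵀ * mom x * truncId p q)) lam

/-- The algebra of spectral invariants of a Lax matrix `L(λ)`, `λ ∈ D`: it is generated by the
coefficients of the characteristic polynomials of the matrices `L(λ)` and by the traces of their
powers. The coefficients of these functions with respect to `λ` belong to it as well whenever they
are Laurent polynomials in `λ` (up to a fixed denominator) and `D` is infinite, being linear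
combinations of finitely many values. -/
def spectralInvariants (L : ℂ → Phase p → BlockMatrix p q) (D : Set ℂ) :
    Subalgebra ℂ (Phase p → ℂ) :=
  Algebra.adjoin ℂ
    ({f | ∃ lam ∈ D, ∃ n : ℕ, f = fun x => (L lam x).charpoly.coeff n} ∪
      {f | ∃ lam ∈ D, ∃ n : ℕ, f = fun x => ((L lam x) ^ n).trace})

/-! ## Tensor notation and kernels -/

/-- Matrices on the tensor square of `ℂ^(p+q)`. -/
abbrev TensorMatrix (p q : ℕ) : Type :=
  Matrix ((Fin p ⊕ Fin q) × (Fin p ⊕ Fin q)) ((Fin p ⊕ Fin q) × (Fin p ⊕ Fin q)) ℂ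

/-- The matrix `{A₁, B₂}` of all the Poisson brackets of the entries of `A` with those of `B`;
its entries are placed as in `A ⊗ B`. -/
def tensorBracket (A B : Phase p → BlockMatrix p q) (x : Phase p) : TensorMatrix p q :=
  Matrix.of fun a b => poisson (fun y => A y a.1 b.1) (fun y => B y a.2 b.2) x

/-- The permutation operator `Π`, `Π (X ⊗ Y) = (Y ⊗ X) Π`. -/
def permOp : TensorMatrix p q := Matrix.of fun a b => if a = b.swap then 1 else 0

/-- The kernel `r₂₁(λ, μ) = Π r₁₂(μ, λ) Π`. -/
def flipKernel (r : ℂ → ℂ → TensorMatrix p q) (lam mu : ℂ) : TensorMatrix p q :=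
  permOp * r mu lam * permOp

/-- The `r`-matrix relation
`{L₁(λ), L₂(μ)} = -([r₁₂(λ, μ), L₁(λ)] - [r₂₁(λ, μ), L₂(μ)])` on all of the phase space, for one
pair `λ, μ`. The overall sign is the one that goes with the sign of the bracket `poisson`. -/
def RMatrixRelation (L : ℂ → Phase p → BlockMatrix p q) (r : ℂ → ℂ → TensorMatrix p q)
    (lam mu : ℂ) : Prop :=
  ∀ x : Phase p, tensorBracket (L lam) (L mu) x =
    -(⁅r lam mu, L lam x ⊗ₖ (1 : BlockMatrix p q)⁆
      - ⁅flipKernel r lam mu, (1 : BlockMatrix p q) ⊗ₖ L mu x⁆)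

/-- Indices of the basis `Z_α` of `so(p) ⊕ so(q)`: a pair `i < j` in the first or in the second
block. -/
abbrev ZIndex (p q : ℕ) : Type :=
  {a : Fin p × Fin p // a.1 < a.2} ⊕ {a : Fin q × Fin q // a.1 < a.2}

/-- The antisymmetric matrices `Z_α`. -/
def zMat : ZIndex p q → BlockMatrix p q
  | Sum.inl a => Matrix.single (Sum.inl a.1.1) (Sum.inl a.1.2) 1
      - Matrix.single (Sum.inl a.1.2) (Sum.inl a.1.1) 1
  | Sum.inr a => Matrix.single (Sum.inr a.1.1) (Sum.inr a.1.2) 1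
      - Matrix.single (Sum.inr a.1.2) (Sum.inr a.1.1) 1

/-- The symmetric matrices `S_β`, `β = (i, j)`. -/
def sMat (b : Fin p × Fin q) : BlockMatrix p q :=
  Matrix.single (Sum.inl b.1) (Sum.inr b.2) 1 + Matrix.single (Sum.inr b.2) (Sum.inl b.1) 1

/-- `P_𝔣 = ∑ Z_α ⊗ Z_α`. -/
def casimirF : TensorMatrix p q := ∑ a : ZIndex p q, zMat a ⊗ₖ zMat a

/-- `P_𝔭 = ∑ S_β ⊗ S_β`. -/
def casimirP : TensorMatrix p q := ∑ b : Fin p × Fin q, sMat b ⊗ₖ sMat b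

/-- `r₁₂(λ, μ) = -λ²/(λ² - μ²) P_𝔣 + λμ/(λ² - μ²) P_𝔭`. -/
def rKernel (lam mu : ℂ) : TensorMatrix p q :=
  (-(lam ^ 2 / (lam ^ 2 - mu ^ 2))) • casimirF + (lam * mu / (lam ^ 2 - mu ^ 2)) • casimirP

/-- The kernel of the body frame, `r̃₁₂(λ, μ) = -r₁₂(λ⁻¹, μ⁻¹)`. -/
def rBody (lam mu : ℂ) : TensorMatrix p q := -rKernel lam⁻¹ mu⁻¹

/-- The image `P̂ Z_α P̂` of `Z_α`. A generator `e_ij - e_ji` of `so(p)` goes to the generator of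
`so(q)` with the same indices if `i, j ≤ q` and to `0` otherwise; the generators of `so(q)` are
fixed. -/
def hatP : ZIndex p q → BlockMatrix p q
  | Sum.inl a =>
      if h : (a.1.1 : ℕ) < q ∧ (a.1.2 : ℕ) < q then
        zMat (Sum.inr ⟨(⟨a.1.1, h.1⟩, ⟨a.1.2, h.2⟩), a.2⟩)
      else 0
  | Sum.inr a => zMat (Sum.inr a)

/-- The term `∑ Z_α ⊗ P̂ Z_α P̂`. -/
def hatSum : TensorMatrix p q := ∑ a : ZIndex p q, zMat a ⊗ₖ hatP a

/-- The reduced kernel `r̃₁₂^Kow(λ, μ) = r̃₁₂(λ, μ) - ∑ Z_α ⊗ P̂ Z_α P̂`. -/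
def rKow (lam mu : ℂ) : TensorMatrix p q := rBody lam mu - hatSum

/-- The dressed kernel
`r̃₁₂^zKow(λ, μ) = [1 ⊗ (1 - μ z̃)⁻¹] (r̃₁₂(λ, μ) [(1 - λ z̃) ⊗ 1] - ∑ Z_α ⊗ P̂ Z_α P̂)`. -/
def rKowZ (c : ℂ) (lam mu : ℂ) : TensorMatrix p q :=
  ((1 : BlockMatrix p q) ⊗ₖ (1 - mu • zTilde c (truncId p q))⁻¹) *
    (rBody lam mu * ((1 - lam • zTilde c (truncId p q)) ⊗ₖ (1 : BlockMatrix p q)) - hatSum)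

/-- The spectral parameters at which `L̃(λ)` is defined. -/
def domainKow : Set ℂ := {lam | lam ≠ 0}

/-- The spectral parameters at which the perturbed matrix `L̃_z(λ)` is defined. -/
def domainKowZ (p q : ℕ) (c : ℂ) : Set ℂ :=
  {lam | lam ≠ 0 ∧ (1 - lam • zTilde c (truncId p q)).det ≠ 0}

end KowalevskiTop

end

open scoped Matrix Kronecker

noncomputable section

namespace KowalevskiTop

/-! ### The contracted r-matrix identity for block matrices. -/

section BlockIdentity

/-! The unperturbed Lax matrix and kernel are the case `c = 0` of the perturbed ones, so only
`laxKowZ` and `rKowZ` need work.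

An operator on the tensor square is determined by the partial traces `tr₂ (T (1 ⊗ B))` over all `B`
(`ext_contract`). Under this contraction `P_𝔣`, `P_𝔭` and the hat term become explicit linear maps
of `B`, left or right multiplication in the second factor is absorbed into `B`, and the r-matrix
relation becomes an equation between matrices of size `p + q`. Write `L_z(λ) = N(λ)⁻¹ M(λ)` with `N
= 1 - λ z̃`. Testing against `B N(μ)` and multiplying by `N(λ)` removes the inverses. This works
because the matrices `diag(E Y Eᵀ, Y)`, in which the contracted hat term takes its values, commute
with `z̃` when `Eᵀ E = 1`; this is where `q ≤ p` enters. What remains is `bracketNum_eq`, a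
noncommutative polynomial identity in the blocks with coefficients rational in `λ`, `μ`, `c`. It
uses only `Eᵀ E = 1` and `ℓᵀ = -ℓ`, and holds for every `S` in place of `kᵀ F`.

For involution, traces of powers and coefficients of the characteristic polynomial have gradients
`G(A)` commuting with `A`. By the chain rule the bracket of two such functions is the trace of `(G ⊗
H) {L₁, L₂}` (`poisson_spectral`), and the relation writes `{L₁, L₂}` through commutators with `L₁`
and `L₂`, which this trace kills. The excluded case `λ² = μ²` follows by continuity in `μ`, and the
passage to the generated algebra is the Leibniz rule. -/

theorem fromBlocks_sub {m n : Type} (a a' : Matrix m m ℂ) (b b' : Matrix m n ℂ)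
    (c c' : Matrix n m ℂ) (d d' : Matrix n n ℂ) :
    Matrix.fromBlocks a b c d - Matrix.fromBlocks a' b' c' d' =
      Matrix.fromBlocks (a - a') (b - b') (c - c') (d - d') := by
  simp only [sub_eq_add_neg, Matrix.fromBlocks_neg, Matrix.fromBlocks_add]

variable {m n : Type} [Fintype m] [Fintype n] [DecidableEq m] [DecidableEq n]

/-- The matrix `diag(X, -Eᵀ X E)`. -/
def momBlock (E : Matrix m n ℂ) (X : Matrix m m ℂ) : Matrix (m ⊕ n) (m ⊕ n) ℂ :=
  Matrix.fromBlocks X 0 0 (-(Eᵀ * X * E))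

/-- The symmetric matrix with off-diagonal blocks `S` and `Sᵀ`. -/
def symB (S : Matrix m n ℂ) : Matrix (m ⊕ n) (m ⊕ n) ℂ :=
  Matrix.fromBlocks 0 S Sᵀ 0

/-- The matrix `c (0, E; -Eᵀ, 0)`. -/
def skewB (c : ℂ) (E : Matrix m n ℂ) : Matrix (m ⊕ n) (m ⊕ n) ℂ :=
  c • Matrix.fromBlocks 0 E (-Eᵀ) 0

/-- The numerator `L̃(λ) - (z̃ s̃ + s̃ z̃) / 2` of the perturbed Lax matrix. -/
def laxNum (c : ℂ) (E S : Matrix m n ℂ) (l : Matrix m m ℂ) (lam : ℂ) :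
    Matrix (m ⊕ n) (m ⊕ n) ℂ :=
  lam • symB E - momBlock E l + lam⁻¹ • symB S
    - (1 / 2 : ℂ) • (skewB c E * symB S + symB S * skewB c E)

/-- The derivative of `symB (kᵀ F)` along `k ↦ k X`, with `S = kᵀ F`. -/
def symVar (S : Matrix m n ℂ) (X : Matrix m m ℂ) : Matrix (m ⊕ n) (m ⊕ n) ℂ :=
  Matrix.fromBlocks 0 (-(X * S)) (Sᵀ * X) 0

/-- The derivative of `laxNum` along `k ↦ k X`, with `S = kᵀ F`. -/
def rotVar (c : ℂ) (E S : Matrix m n ℂ) (lam : ℂ) (X : Matrix m m ℂ) :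
    Matrix (m ⊕ n) (m ⊕ n) ℂ :=
  lam⁻¹ • symVar S X - (1 / 2 : ℂ) • (skewB c E * symVar S X + symVar S X * skewB c E)

/-- The transpose of `momBlock` with respect to the trace form. -/
def momDual (E : Matrix m n ℂ) (B : Matrix (m ⊕ n) (m ⊕ n) ℂ) : Matrix m m ℂ :=
  B.toBlocks₁₁ - E * B.toBlocks₂₂ * Eᵀ

/-- The transpose of `symVar` with respect to the trace form. -/
def symDual (S : Matrix m n ℂ) (B : Matrix (m ⊕ n) (m ⊕ n) ℂ) : Matrix m m ℂ :=
  B.toBlocks₁₂ * Sᵀ - S * B.toBlocks₂₁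

/-- The transpose of `rotVar` with respect to the trace form. -/
def rotDual (c : ℂ) (E S : Matrix m n ℂ) (mu : ℂ) (B : Matrix (m ⊕ n) (m ⊕ n) ℂ) :
    Matrix m m ℂ :=
  mu⁻¹ • symDual S B - (1 / 2 : ℂ) • symDual S (B * skewB c E + skewB c E * B)

/-- Contraction of the second factor of `P_𝔣`. -/
def contrF (B : Matrix (m ⊕ n) (m ⊕ n) ℂ) : Matrix (m ⊕ n) (m ⊕ n) ℂ :=
  Matrix.fromBlocks (B.toBlocks₁₁ᵀ - B.toBlocks₁₁) 0 0 (B.toBlocks₂₂ᵀ - B.toBlocks₂₂)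

/-- Contraction of the second factor of `P_𝔭`. -/
def contrP (B : Matrix (m ⊕ n) (m ⊕ n) ℂ) : Matrix (m ⊕ n) (m ⊕ n) ℂ :=
  Matrix.fromBlocks 0 (B.toBlocks₁₂ + B.toBlocks₂₁ᵀ) (B.toBlocks₂₁ + B.toBlocks₁₂ᵀ) 0

/-- Contraction of the second factor of `∑ Z_α ⊗ P̂ Z_α P̂`. -/
def contrH (E : Matrix m n ℂ) (B : Matrix (m ⊕ n) (m ⊕ n) ℂ) : Matrix (m ⊕ n) (m ⊕ n) ℂ :=
  Matrix.fromBlocks (E * (B.toBlocks₂₂ᵀ - B.toBlocks₂₂) * Eᵀ) 0 0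
    (B.toBlocks₂₂ᵀ - B.toBlocks₂₂)

/-- Contraction of the first factor of `∑ Z_α ⊗ P̂ Z_α P̂`. -/
def contrHFlip (E : Matrix m n ℂ) (B : Matrix (m ⊕ n) (m ⊕ n) ℂ) :
    Matrix (m ⊕ n) (m ⊕ n) ℂ :=
  Matrix.fromBlocks 0 0 0 (Eᵀ * (B.toBlocks₁₁ᵀ - B.toBlocks₁₁) * E
    + (B.toBlocks₂₂ᵀ - B.toBlocks₂₂))

/-- Contraction of either factor of `α P_𝔣 + β P_𝔭`. -/
def contrR (a b : ℂ) (B : Matrix (m ⊕ n) (m ⊕ n) ℂ) : Matrix (m ⊕ n) (m ⊕ n) ℂ :=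
  a • contrF B + b • contrP B

/-- The contraction of `{L₁, L₂}` for the numerators of the Lax matrices. -/
def bracketNum (c : ℂ) (E S : Matrix m n ℂ) (l : Matrix m m ℂ) (lam mu : ℂ)
    (B : Matrix (m ⊕ n) (m ⊕ n) ℂ) : Matrix (m ⊕ n) (m ⊕ n) ℂ :=
  -momBlock E ((rotDual c E S mu B)ᵀ - rotDual c E S mu B)
    + rotVar c E S lam ((momDual E B)ᵀ - momDual E B)
    - momBlock E (l * ((momDual E B)ᵀ - momDual E B) - ((momDual E B)ᵀ - momDual E B) * l)

/-- This is the r-matrix relation tested against `B (1 - μ z̃)` and multiplied on the left by `1 - λ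
z̃`. The two pairs of coefficients are those of `r̃(λ, μ)` and `r̃(μ, λ)`. The hat terms carry no
factor `1 - λ z̃` because they are compatible with `z̃`. -/
theorem bracketNum_eq (c : ℂ) (E S : Matrix m n ℂ) (l : Matrix m m ℂ) (lam mu : ℂ)
    (B : Matrix (m ⊕ n) (m ⊕ n) ℂ) (hE : Eᵀ * E = 1) (hl : lᵀ = -l) (hlam : lam ≠ 0)
    (hmu : mu ≠ 0) (hne : lam ^ 2 ≠ mu ^ 2) :
    bracketNum c E S l lam mu B =
      -((1 - lam • skewB c E) * contrR (mu ^ 2 / (mu ^ 2 - lam ^ 2))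
            (-(lam * mu / (mu ^ 2 - lam ^ 2))) B * laxNum c E S l lam
          - laxNum c E S l lam * contrR (mu ^ 2 / (mu ^ 2 - lam ^ 2))
            (-(lam * mu / (mu ^ 2 - lam ^ 2))) B * (1 - lam • skewB c E)
          - (contrH E B * laxNum c E S l lam - laxNum c E S l lam * contrH E B)
          - contrR (lam ^ 2 / (lam ^ 2 - mu ^ 2)) (-(lam * mu / (lam ^ 2 - mu ^ 2)))
            (laxNum c E S l mu * B * (1 - mu • skewB c E)
              - (1 - mu • skewB c E) * B * laxNum c E S l mu)
          + contrHFlip E (laxNum c E S l mu * B - B * laxNum c E S l mu)) := by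
  obtain ⟨b₁, b₂, b₃, b₄, rfl⟩ : ∃ b₁ b₂ b₃ b₄, B = Matrix.fromBlocks b₁ b₂ b₃ b₄ :=
    ⟨_, _, _, _, (Matrix.fromBlocks_toBlocks B).symm⟩
  have h1 : (1 : Matrix (m ⊕ n) (m ⊕ n) ℂ) = Matrix.fromBlocks 1 0 0 1 :=
    Matrix.fromBlocks_one.symm
  have hE' : ∀ {k : Type} (X : Matrix n k ℂ), Eᵀ * (E * X) = X := by
    intro k X; rw [← Matrix.mul_assoc, hE, Matrix.one_mul]
  have d1 : mu ^ 2 - lam ^ 2 ≠ 0 := sub_ne_zero.2 (Ne.symm hne)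
  have d3 : (lam ^ 2 - mu ^ 2) = -(mu ^ 2 - lam ^ 2) := by ring
  -- All fractions are put over one denominator, so that a single nonvanishing hypothesis clears
  -- them.
  rw [d3]
  simp only [bracketNum, momBlock, rotVar, rotDual, symDual, momDual, symVar, skewB, contrR,
    contrF, contrP, contrH, contrHFlip, laxNum, symB, h1, Matrix.fromBlocks_smul,
    Matrix.fromBlocks_neg, Matrix.fromBlocks_add, fromBlocks_sub,
    Matrix.fromBlocks_multiply, Matrix.toBlocks_fromBlocks₁₁, Matrix.toBlocks_fromBlocks₁₂,
    Matrix.toBlocks_fromBlocks₂₁, Matrix.toBlocks_fromBlocks₂₂, smul_zero, neg_zero, add_zero,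
    zero_add, sub_zero, zero_sub, Matrix.mul_zero, Matrix.zero_mul, Matrix.fromBlocks_inj]
  simp only [Matrix.transpose_sub, Matrix.transpose_add, Matrix.transpose_neg,
    Matrix.transpose_mul, Matrix.transpose_smul, Matrix.transpose_transpose,
    Matrix.transpose_one, hl]
  simp only [Matrix.mul_add, Matrix.add_mul, Matrix.mul_sub, Matrix.sub_mul, Matrix.mul_neg,
    Matrix.neg_mul, Matrix.mul_smul, Matrix.smul_mul, Matrix.mul_assoc, Matrix.mul_one,
    Matrix.one_mul, hE, hE']
  refine ⟨?_, ?_, ?_, ?_⟩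
  all_goals
    -- With `Eᵀ E` cancelled and `lᵀ` replaced, both sides are combinations of words in the blocks;
    -- comparing them word by word leaves rational identities in `λ`, `μ`, `c`.
    match_scalars <;> (try field_simp) <;> (try ring)

end BlockIdentity

/-! ### Partial trace over the second tensor factor. -/

section Contraction

variable {N : Type} [Fintype N]

/-- The partial trace `T ↦ tr₂ (T (1 ⊗ B))`. -/
def contract (B : Matrix N N ℂ) : Matrix (N × N) (N × N) ℂ →ₗ[ℂ] Matrix N N ℂ where
  toFun T := Matrix.of fun a b => ∑ c, ∑ d, T (a, c) (b, d) * B d c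
  map_add' T T' := by
    ext a b
    simp [add_mul, Finset.sum_add_distrib]
  map_smul' t T := by
    ext a b
    simp [Finset.mul_sum, mul_assoc]

theorem contract_apply (B : Matrix N N ℂ) (T : Matrix (N × N) (N × N) ℂ) (a b : N) :
    contract B T a b = ∑ c, ∑ d, T (a, c) (b, d) * B d c := rfl

theorem contract_kronecker (B X Y : Matrix N N ℂ) :
    contract B (X ⊗ₖ Y) = (Y * B).trace • X := by
  ext a b
  simp only [contract_apply, Matrix.kroneckerMap_apply, Matrix.smul_apply, Matrix.trace,
    Matrix.diag_apply, Matrix.mul_apply, smul_eq_mul, Finset.sum_mul]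
  exact Finset.sum_congr rfl fun _ _ => Finset.sum_congr rfl fun _ _ => by ring

variable [DecidableEq N]

/-- Testing against a matrix unit isolates a single index pair of the second factor, so the partial
traces see every entry. -/
theorem ext_contract {T T' : Matrix (N × N) (N × N) ℂ}
    (h : ∀ B, contract B T = contract B T') : T = T' := by
  ext ⟨a, c⟩ ⟨b, d⟩
  have := congrFun (congrFun (h (Matrix.single d c 1)) a) b
  simpa [contract_apply, Matrix.single_apply, ite_and] using this

theorem contract_fst_mul (B X : Matrix N N ℂ) (T : Matrix (N × N) (N × N) ℂ) :
    contract B ((X ⊗ₖ (1 : Matrix N N ℂ)) * T) = X * contract B T := by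
  ext a b
  simp only [contract_apply, Matrix.mul_apply, Matrix.kroneckerMap_apply, Matrix.one_apply,
    Fintype.sum_prod_type, mul_ite, mul_one, mul_zero, ite_mul, zero_mul, Finset.sum_ite_eq,
    Finset.mem_univ, if_true, Finset.mul_sum, Finset.sum_mul]
  rw [Finset.sum_comm_cycle]
  exact Finset.sum_congr rfl fun _ _ => Finset.sum_congr rfl fun _ _ =>
    Finset.sum_congr rfl fun _ _ => by ring

theorem contract_mul_fst (B X : Matrix N N ℂ) (T : Matrix (N × N) (N × N) ℂ) :
    contract B (T * (X ⊗ₖ (1 : Matrix N N ℂ))) = contract B T * X := by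
  ext a b
  simp only [contract_apply, Matrix.mul_apply, Matrix.kroneckerMap_apply, Matrix.one_apply,
    Fintype.sum_prod_type, mul_ite, mul_one, mul_zero, Finset.sum_ite_eq',
    Finset.mem_univ, if_true, Finset.sum_mul]
  rw [Finset.sum_comm_cycle]
  exact Finset.sum_congr rfl fun _ _ => Finset.sum_congr rfl fun _ _ =>
    Finset.sum_congr rfl fun _ _ => by ring

/-- The trace is cyclic in the second factor, so a factor `1 ⊗ Y` on either side of `T` can be moved
onto `B`; on the right of `T` it becomes a left factor of `B`. -/
theorem contract_mul_snd (B Y : Matrix N N ℂ) (T : Matrix (N × N) (N × N) ℂ) :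
    contract B (T * ((1 : Matrix N N ℂ) ⊗ₖ Y)) = contract (Y * B) T := by
  ext a b
  simp only [contract_apply, Matrix.mul_apply, Matrix.kroneckerMap_apply, Matrix.one_apply,
    Fintype.sum_prod_type_right, mul_ite, mul_zero, ite_mul, one_mul, zero_mul,
    Finset.sum_ite_eq', Finset.mem_univ, if_true, Finset.mul_sum, Finset.sum_mul]
  refine Finset.sum_congr rfl fun _ _ => ?_
  rw [Finset.sum_comm]
  exact Finset.sum_congr rfl fun _ _ => Finset.sum_congr rfl fun _ _ => by ring

theorem contract_snd_mul (B Y : Matrix N N ℂ) (T : Matrix (N × N) (N × N) ℂ) :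
    contract B (((1 : Matrix N N ℂ) ⊗ₖ Y) * T) = contract (B * Y) T := by
  ext a b
  simp only [contract_apply, Matrix.mul_apply, Matrix.kroneckerMap_apply, Matrix.one_apply,
    Fintype.sum_prod_type_right, ite_mul, one_mul, zero_mul, Finset.sum_ite_eq,
    Finset.mem_univ, if_true, Finset.mul_sum, Finset.sum_mul]
  rw [Finset.sum_comm_cycle]
  refine Finset.sum_congr rfl fun _ _ => ?_
  rw [Finset.sum_comm]
  exact Finset.sum_congr rfl fun _ _ => Finset.sum_congr rfl fun _ _ => by ring

end Contraction

/-! ### Traces and sums over the generators of `so`. -/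

section Generators

variable {m n : Type}

theorem sum_smul_fromBlocks_diag {ι : Type} (s : Finset ι) (f : ι → ℂ) (X : ι → Matrix m m ℂ)
    (Y : ι → Matrix n n ℂ) :
    ∑ i ∈ s, f i • Matrix.fromBlocks (X i) 0 0 (Y i) =
      Matrix.fromBlocks (∑ i ∈ s, f i • X i) 0 0 (∑ i ∈ s, f i • Y i) := by
  ext (a | a) (b | b) <;> simp [Matrix.sum_apply]

variable [Fintype m] [Fintype n]

theorem trace_fromBlocks_diag_mul (X : Matrix m m ℂ) (Y : Matrix n n ℂ)
    (B : Matrix (m ⊕ n) (m ⊕ n) ℂ) :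
    (Matrix.fromBlocks X 0 0 Y * B).trace =
      (X * B.toBlocks₁₁).trace + (Y * B.toBlocks₂₂).trace := by
  conv_lhs => rw [← Matrix.fromBlocks_toBlocks B, Matrix.fromBlocks_multiply]
  simp [Matrix.trace, Fintype.sum_sum_type]

theorem trace_fromBlocks_antidiag_mul (X : Matrix m n ℂ) (Y : Matrix n m ℂ)
    (B : Matrix (m ⊕ n) (m ⊕ n) ℂ) :
    (Matrix.fromBlocks 0 X Y 0 * B).trace =
      (X * B.toBlocks₂₁).trace + (Y * B.toBlocks₁₂).trace := by
  conv_lhs => rw [← Matrix.fromBlocks_toBlocks B, Matrix.fromBlocks_multiply]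
  simp [Matrix.trace, Fintype.sum_sum_type]

variable [DecidableEq m]

/-- The complex matrix `e_ij - e_ji`. -/
def skewUnit (i j : m) : Matrix m m ℂ := Matrix.single i j 1 - Matrix.single j i 1

theorem trace_skewUnit_mul (i j : m) (b : Matrix m m ℂ) :
    (skewUnit i j * b).trace = b j i - b i j := by
  simp [skewUnit, sub_mul, Matrix.trace_single_mul]

theorem sum_smul_skewUnit (C : Matrix m m ℂ) :
    ∑ i, ∑ j, C i j • skewUnit i j = C - Cᵀ := by
  ext x y
  simp [skewUnit, Matrix.sum_apply, Matrix.single_apply, ite_and, mul_sub,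
    Finset.sum_sub_distrib]

/-- The generators with `i < j` are orthogonal for the trace form, each of square `-2`, so the sum
is `-2` times the projection of `C` onto skew matrices. -/
theorem sum_lt_smul_skewUnit {k : ℕ} (C : Matrix (Fin k) (Fin k) ℂ) :
    ∑ a : {a : Fin k × Fin k // a.1 < a.2},
      (skewUnit a.1.1 a.1.2 * C).trace • skewUnit a.1.1 a.1.2 = Cᵀ - C := by
  simp only [trace_skewUnit_mul]
  rw [← Finset.sum_subtype (Finset.univ.filter fun a : Fin k × Fin k => a.1 < a.2)
    (fun x => by simp) fun a => (C a.2 a.1 - C a.1 a.2) • skewUnit a.1 a.2,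
    Finset.sum_filter, Fintype.sum_prod_type]
  ext x y
  have h : ∀ i j : Fin k, (if i < j then (C j i - C i j) • skewUnit i j else 0) x y =
      (if i = x then if j = y then if i < j then C j i - C i j else 0 else 0 else 0)
        - (if j = x then if i = y then if i < j then C j i - C i j else 0 else 0 else 0) := by
    intro i j
    by_cases h1 : i < j
    · simp only [h1, if_true, Matrix.smul_apply, skewUnit, Matrix.sub_apply, Matrix.single_apply,
        ite_and, smul_eq_mul, mul_sub, mul_ite, mul_one, mul_zero]
    · simp [h1]
  simp only [Matrix.sum_apply, h, Finset.sum_sub_distrib, Finset.sum_ite_irrel,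
    Finset.sum_const_zero, Finset.sum_ite_eq', Finset.mem_univ, if_true]
  rcases lt_trichotomy x y with hxy | rfl | hxy
  · simp [hxy, hxy.not_gt]
  · simp
  · simp [hxy, hxy.not_gt]

end Generators

/-! ### Contractions of the Casimir elements and of the hat term. -/

section Casimir

variable {p q : ℕ}

theorem zMat_inl (a : {a : Fin p × Fin p // a.1 < a.2}) :
    (zMat (Sum.inl a) : BlockMatrix p q) = Matrix.fromBlocks (skewUnit a.1.1 a.1.2) 0 0 0 := by
  ext (x | x) (y | y) <;> simp [zMat, skewUnit, Matrix.single_apply]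

theorem zMat_inr (a : {a : Fin q × Fin q // a.1 < a.2}) :
    (zMat (Sum.inr a) : BlockMatrix p q) = Matrix.fromBlocks 0 0 0 (skewUnit a.1.1 a.1.2) := by
  ext (x | x) (y | y) <;> simp [zMat, skewUnit, Matrix.single_apply]

theorem cx_truncId_apply (i : Fin p) (j : Fin q) :
    cx (truncId p q) i j = if (i : ℕ) = (j : ℕ) then 1 else 0 := by
  simp only [cx, truncId, Matrix.map_apply, Matrix.of_apply]
  split_ifs <;> simp

theorem truncId_transpose_mul_skewUnit_mul (i j : Fin p) (x y : Fin q) :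
    ((cx (truncId p q))ᵀ * skewUnit i j * cx (truncId p q)) x y =
      (if (i : ℕ) = x ∧ (j : ℕ) = y then 1 else 0)
        - (if (j : ℕ) = x ∧ (i : ℕ) = y then 1 else 0) := by
  have h : ∀ i j : Fin p, ((cx (truncId p q))ᵀ * Matrix.single i j (1 : ℂ) * cx (truncId p q)) x y =
      cx (truncId p q) i x * cx (truncId p q) j y := by
    intro i j
    simp [Matrix.mul_apply, Matrix.single_apply, ite_and]
  simp [skewUnit, Matrix.mul_sub, Matrix.sub_mul, h, cx_truncId_apply, ite_and]
  split_ifs <;> rfl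

/-- Conjugation by the truncated identity cuts a generator down to its upper left `q × q` corner,
which makes the case distinction in `hatP` a single linear formula. -/
theorem hatP_inl (a : {a : Fin p × Fin p // a.1 < a.2}) :
    (hatP (Sum.inl a) : BlockMatrix p q) = Matrix.fromBlocks 0 0 0
      ((cx (truncId p q))ᵀ * skewUnit a.1.1 a.1.2 * cx (truncId p q)) := by
  by_cases h : (a.1.1 : ℕ) < q ∧ (a.1.2 : ℕ) < q
  · rw [hatP, dif_pos h, zMat_inr]
    congr 1
    ext x y
    rw [truncId_transpose_mul_skewUnit_mul]
    simp [skewUnit, Matrix.single_apply, Fin.ext_iff]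
  · rw [hatP, dif_neg h]
    ext (x | x) (y | y)
    · rfl
    · rfl
    · rfl
    · rw [Matrix.fromBlocks_apply₂₂, truncId_transpose_mul_skewUnit_mul, if_neg, if_neg]
      · simp
      · exact fun e => h ⟨e.2 ▸ y.2, e.1 ▸ x.2⟩
      · exact fun e => h ⟨e.1 ▸ x.2, e.2 ▸ y.2⟩

theorem truncId_transpose_mul_truncId (hqp : q ≤ p) :
    (cx (truncId p q))ᵀ * cx (truncId p q) = 1 := by
  ext x y
  rw [Matrix.mul_apply, Finset.sum_eq_single (Fin.castLE hqp x)]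
  · simp [cx_truncId_apply, Matrix.one_apply, Fin.ext_iff]
  · intro b _ hb
    rw [Matrix.transpose_apply, cx_truncId_apply, if_neg, zero_mul]
    exact fun e => hb (Fin.ext e)
  · simp

theorem contract_casimirF (B : BlockMatrix p q) : contract B casimirF = contrF B := by
  simp only [casimirF, map_sum, map_add, Fintype.sum_sum_type, contract_kronecker, zMat_inl, zMat_inr,
    trace_fromBlocks_diag_mul, sum_smul_fromBlocks_diag, zero_mul, Matrix.trace_zero,
    add_zero, zero_add, smul_zero, Finset.sum_const_zero, sum_lt_smul_skewUnit,
    Matrix.fromBlocks_add, contrF]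

theorem hatP_inr (a : {a : Fin q × Fin q // a.1 < a.2}) :
    (hatP (Sum.inr a) : BlockMatrix p q) = Matrix.fromBlocks 0 0 0 (skewUnit a.1.1 a.1.2) :=
  zMat_inr a

theorem trace_sandwich (X : Matrix (Fin p) (Fin p) ℂ) (E : Matrix (Fin p) (Fin q) ℂ)
    (Y : Matrix (Fin q) (Fin q) ℂ) : (Eᵀ * X * E * Y).trace = (X * (E * Y * Eᵀ)).trace := by
  rw [Matrix.mul_assoc, Matrix.mul_assoc, Matrix.trace_mul_comm, Matrix.mul_assoc]

theorem contract_hatSum (B : BlockMatrix p q) :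
    contract B hatSum = contrH (cx (truncId p q)) B := by
  simp only [hatSum, map_sum, map_add, Fintype.sum_sum_type, contract_kronecker, zMat_inl, zMat_inr,
    hatP_inl, hatP_inr, trace_sandwich,
    trace_fromBlocks_diag_mul, sum_smul_fromBlocks_diag, Matrix.zero_mul, Matrix.trace_zero,
    add_zero, zero_add, smul_zero, Finset.sum_const_zero, sum_lt_smul_skewUnit,
    Matrix.fromBlocks_add, contrH]
  simp only [Matrix.transpose_mul, Matrix.transpose_transpose, Matrix.mul_sub, Matrix.sub_mul,
    Matrix.mul_assoc]

theorem permOp_mul_kronecker_mul (X Y : BlockMatrix p q) :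
    permOp * (X ⊗ₖ Y) * permOp = Y ⊗ₖ X := by
  ext ⟨a, c⟩ ⟨b, d⟩
  simp [permOp, Matrix.mul_apply, Fintype.sum_prod_type, ite_and, mul_comm]

theorem contract_flip_hatSum (B : BlockMatrix p q) :
    contract B (permOp * hatSum * permOp) = contrHFlip (cx (truncId p q)) B := by
  simp only [hatSum, Matrix.mul_sum, Matrix.sum_mul, permOp_mul_kronecker_mul]
  simp only [map_sum, map_add, Fintype.sum_sum_type, contract_kronecker, zMat_inl, zMat_inr,
    hatP_inl, hatP_inr,
    trace_fromBlocks_diag_mul, sum_smul_fromBlocks_diag, Matrix.zero_mul, Matrix.trace_zero,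
    add_zero, zero_add, smul_zero, Finset.sum_const_zero, sum_lt_smul_skewUnit,
    Matrix.fromBlocks_add, contrHFlip]
  simp only [← sum_lt_smul_skewUnit B.toBlocks₁₁, Matrix.mul_sum, Matrix.sum_mul,
    Matrix.mul_smul, Matrix.smul_mul]

theorem permOp_mul_casimirF_mul :
    permOp * (casimirF : TensorMatrix p q) * permOp = casimirF := by
  simp only [casimirF, Matrix.mul_sum, Matrix.sum_mul, permOp_mul_kronecker_mul]

theorem permOp_mul_casimirP_mul :
    permOp * (casimirP : TensorMatrix p q) * permOp = casimirP := by
  simp only [casimirP, Matrix.mul_sum, Matrix.sum_mul, permOp_mul_kronecker_mul]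

theorem contract_casimirP (B : BlockMatrix p q) : contract B casimirP = contrP B := by
  have h : ∀ b : Fin p × Fin q, (sMat b * B).trace =
      B (Sum.inr b.2) (Sum.inl b.1) + B (Sum.inl b.1) (Sum.inr b.2) := by
    intro b
    simp [sMat, Matrix.add_mul, Matrix.trace_single_mul]
  simp only [casimirP, map_sum, contract_kronecker, h, Fintype.sum_prod_type, contrP]
  ext (x | x) (y | y) <;>
    simp [sMat, Matrix.sum_apply, Matrix.single_apply, ite_and, Matrix.toBlocks₁₂,
      Matrix.toBlocks₂₁, add_comm]

end Casimir

/-! ### Derivatives of the Lax matrix along momenta and rotations. -/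

section Derivatives

variable {p q : ℕ}

/-- Expanding `Λ` in matrix units reduces the claim to finite sums of entries, so no norm on
matrices has to be chosen. -/
theorem hasDerivAt_linearMap_comp {m n : Type} [Fintype m] [Fintype n]
    (Λ : Matrix m n ℂ →ₗ[ℂ] ℂ) {S : ℝ → Matrix m n ℂ} {S' : Matrix m n ℂ} {t₀ : ℝ}
    (h : ∀ i j, HasDerivAt (fun t => S t i j) (S' i j) t₀) :
    HasDerivAt (fun t => Λ (S t)) (Λ S') t₀ := by
  classical
  have e : ∀ M : Matrix m n ℂ, Λ M = ∑ i, ∑ j, M i j * Λ (Matrix.single i j 1) := by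
    intro M
    conv_lhs => rw [Matrix.matrix_eq_sum_single M]
    simp only [map_sum]
    refine Finset.sum_congr rfl fun i _ => Finset.sum_congr rfl fun j _ => ?_
    rw [← smul_eq_mul, ← map_smul, Matrix.smul_single, smul_eq_mul, mul_one]
  rw [funext fun t => e (S t), e S']
  exact HasDerivAt.fun_sum fun i _ => HasDerivAt.fun_sum fun j _ => (h i j).mul_const _

/-- The entry `(a, b)` of `M * momBlock E X` as a linear function of `X`. -/
def momEntry (M : BlockMatrix p q) (E : Matrix (Fin p) (Fin q) ℂ) (a b : Fin p ⊕ Fin q) :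
    Matrix (Fin p) (Fin p) ℂ →ₗ[ℂ] ℂ where
  toFun X := (M * momBlock E X) a b
  map_add' X Y := by
    have : momBlock E (X + Y) = momBlock E X + momBlock E Y := by
      simp only [momBlock, Matrix.fromBlocks_add, Matrix.mul_add, Matrix.add_mul, neg_add,
        add_zero]
    rw [this, Matrix.mul_add, Matrix.add_apply]
  map_smul' t X := by
    have : momBlock E (t • X) = t • momBlock E X := by
      simp only [momBlock, Matrix.fromBlocks_smul, Matrix.mul_smul, Matrix.smul_mul, smul_neg,
        smul_zero]
    rw [this, Matrix.mul_smul, Matrix.smul_apply]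
    rfl

/-- The part of `laxNum` that is linear in `S = kᵀ F`. -/
def laxLin (c : ℂ) (E S : Matrix (Fin p) (Fin q) ℂ) (lam : ℂ) : BlockMatrix p q :=
  lam⁻¹ • symB S - (1 / 2 : ℂ) • (skewB c E * symB S + symB S * skewB c E)

/-- The entry `(a, b)` of `M * laxLin c E S lam` as a linear function of `S`. -/
def laxLinEntry (M : BlockMatrix p q) (c : ℂ) (E : Matrix (Fin p) (Fin q) ℂ) (lam : ℂ)
    (a b : Fin p ⊕ Fin q) : Matrix (Fin p) (Fin q) ℂ →ₗ[ℂ] ℂ where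
  toFun S := (M * laxLin c E S lam) a b
  map_add' S T := by
    have h : symB (S + T) = symB S + symB T := by
      simp only [symB, Matrix.fromBlocks_add, Matrix.transpose_add, add_zero]
    have : laxLin c E (S + T) lam = laxLin c E S lam + laxLin c E T lam := by
      simp only [laxLin, h, Matrix.mul_add, Matrix.add_mul]
      module
    rw [this, Matrix.mul_add, Matrix.add_apply]
  map_smul' t S := by
    have h : symB (t • S) = t • symB S := by
      simp only [symB, Matrix.fromBlocks_smul, Matrix.transpose_smul, smul_zero]
    have : laxLin c E (t • S) lam = t • laxLin c E S lam := by
      simp only [laxLin, h, Matrix.mul_smul, Matrix.smul_mul]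
      module
    rw [this, Matrix.mul_smul, Matrix.smul_apply]
    rfl

/-- The matrix `1 - λ z̃`. -/
def dress (p q : ℕ) (c lam : ℂ) : BlockMatrix p q := 1 - lam • zTilde c (truncId p q)

theorem dress_eq (c lam : ℂ) : dress p q c lam = 1 - lam • skewB c (cx (truncId p q)) := rfl

theorem laxKowZ_eq (c : ℂ) (F : Matrix (Fin p) (Fin q) ℝ) (lam : ℂ) (x : Phase p) :
    laxKowZ c F lam x = (dress p q c lam)⁻¹ *
      laxNum c (cx (truncId p q)) (cx ((rot x)ᵀ * F)) (cx (mom x)) lam := by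
  have h : cx (-((truncId p q)ᵀ * mom x * truncId p q)) =
      -((cx (truncId p q))ᵀ * cx (mom x) * cx (truncId p q)) := by
    ext i j
    simp [cx, Matrix.mul_apply]
  simp only [laxKowZ, laxBodyZ, laxBody, laxNum, h, Matrix.mul_one]
  rfl

theorem laxNum_eq (c : ℂ) (E S : Matrix (Fin p) (Fin q) ℂ) (l : Matrix (Fin p) (Fin p) ℂ)
    (lam : ℂ) : laxNum c E S l lam = lam • symB E - momBlock E l + laxLin c E S lam := by
  rw [laxNum, laxLin]
  abel

/-- The derivative of `laxKowZ` along `X` in the momentum variable. -/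
def laxDMom (q : ℕ) (c lam : ℂ) (X : Matrix (Fin p) (Fin p) ℂ) : BlockMatrix p q :=
  (dress p q c lam)⁻¹ * -momBlock (cx (truncId p q)) X

/-- The derivative of `laxKowZ` along `k ↦ k X`. -/
def laxDRot (c : ℂ) (F : Matrix (Fin p) (Fin q) ℝ) (lam : ℂ) (x : Phase p)
    (X : Matrix (Fin p) (Fin p) ℂ) : BlockMatrix p q :=
  (dress p q c lam)⁻¹ * rotVar c (cx (truncId p q)) (cx ((rot x)ᵀ * F)) lam X

theorem hasDerivAt_laxKowZ_mom (c : ℂ) (F : Matrix (Fin p) (Fin q) ℝ) (lam : ℂ) (x : Phase p)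
    (X : LieAlgebra.Orthogonal.so (Fin p) ℝ) (a b : Fin p ⊕ Fin q) :
    HasDerivAt (fun t : ℝ => laxKowZ c F lam (x.1, x.2 + t • X) a b)
      (laxDMom q c lam (cx (X : Matrix (Fin p) (Fin p) ℝ)) a b) 0 := by
  have h : ∀ i j, HasDerivAt (fun t : ℝ => cx (mom (x.1, x.2 + t • X)) i j)
      (cx (X : Matrix (Fin p) (Fin p) ℝ) i j) 0 := by
    intro i j
    have h0 : HasDerivAt (fun t : ℝ => mom x i j + t * (X : Matrix (Fin p) (Fin p) ℝ) i j)
        (1 * (X : Matrix (Fin p) (Fin p) ℝ) i j) 0 :=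
      ((hasDerivAt_id (0 : ℝ)).mul_const _).const_add _
    rw [one_mul] at h0
    exact h0.ofReal_comp
  have h2 := (hasDerivAt_linearMap_comp
    (momEntry (dress p q c lam)⁻¹ (cx (truncId p q)) a b) h).const_sub
    (((dress p q c lam)⁻¹ * (lam • symB (cx (truncId p q))
      + laxLin c (cx (truncId p q)) (cx ((rot x)ᵀ * F)) lam)) a b)
  refine (h2.congr_deriv ?_).congr_of_eventuallyEq (.of_forall fun t => ?_)
  rotate_left
  · change laxKowZ c F lam (x.1, x.2 + t • X) a b =
      _ - ((dress p q c lam)⁻¹ * momBlock (_ : Matrix (Fin p) (Fin q) ℂ) _ : BlockMatrix p q) a b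
    rw [laxKowZ_eq, laxNum_eq, ← Matrix.sub_apply, ← Matrix.mul_sub, add_sub_right_comm]
    rfl
  · rw [laxDMom, Matrix.mul_neg]
    rfl

theorem hasDerivAt_rot (X : LieAlgebra.Orthogonal.so (Fin p) ℝ) (i j : Fin p) (x : Phase p) :
    HasDerivAt (fun t : ℝ => rot (x.1 * expSO (t • X), x.2) i j)
      ((rot x * (X : Matrix (Fin p) (Fin p) ℝ)) i j) 0 := by
  open scoped Matrix.Norms.Operator in
  have h0 := hasDerivAt_exp_smul_const (𝕂 := ℝ) (X : Matrix (Fin p) (Fin p) ℝ) (0 : ℝ)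
  rw [zero_smul, NormedSpace.exp_zero, one_mul] at h0
  exact (LinearMap.toContinuousLinearMap ((Matrix.entryLinearMap ℝ ℝ i j).comp
    (LinearMap.mulLeft ℝ (rot x)))).hasFDerivAt.comp_hasDerivAt (0 : ℝ) h0

theorem cx_mul {l m n : Type} [Fintype m] (A : Matrix l m ℝ) (B : Matrix m n ℝ) :
    cx (A * B) = cx A * cx B := by
  ext i j
  simp [cx, Matrix.mul_apply]

theorem cx_so_transpose (X : LieAlgebra.Orthogonal.so (Fin p) ℝ) :
    (cx (X : Matrix (Fin p) (Fin p) ℝ))ᵀ = -cx (X : Matrix (Fin p) (Fin p) ℝ) := by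
  have h := (LieAlgebra.Orthogonal.mem_so _ _ _).1 X.2
  ext i j
  have := congrFun (congrFun h i) j
  simp only [Matrix.transpose_apply, Matrix.neg_apply] at this
  simp [cx, this]

theorem hasDerivAt_laxKowZ_rot (c : ℂ) (F : Matrix (Fin p) (Fin q) ℝ) (lam : ℂ) (x : Phase p)
    (X : LieAlgebra.Orthogonal.so (Fin p) ℝ) (a b : Fin p ⊕ Fin q) :
    HasDerivAt (fun t : ℝ => laxKowZ c F lam (x.1 * expSO (t • X), x.2) a b)
      (laxDRot c F lam x (cx (X : Matrix (Fin p) (Fin p) ℝ)) a b) 0 := by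
  have h : ∀ i j, HasDerivAt (fun t : ℝ => cx ((rot (x.1 * expSO (t • X), x.2))ᵀ * F) i j)
      (cx ((rot x * (X : Matrix (Fin p) (Fin p) ℝ))ᵀ * F) i j) 0 := by
    intro i j
    have h0 : HasDerivAt (fun t : ℝ => ((rot (x.1 * expSO (t • X), x.2))ᵀ * F) i j)
        (((rot x * (X : Matrix (Fin p) (Fin p) ℝ))ᵀ * F) i j) 0 := by
      simp only [Matrix.mul_apply (N := F), Matrix.transpose_apply]
      exact HasDerivAt.fun_sum fun k _ => (hasDerivAt_rot X k i x).mul_const _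
    exact h0.ofReal_comp
  have h2 := (hasDerivAt_linearMap_comp
    (laxLinEntry (dress p q c lam)⁻¹ c (cx (truncId p q)) lam a b) h).const_add
    (((dress p q c lam)⁻¹ * (lam • symB (cx (truncId p q))
      - momBlock (cx (truncId p q)) (cx (mom x)))) a b)
  refine (h2.congr_deriv ?_).congr_of_eventuallyEq (.of_forall fun t => ?_)
  rotate_left
  · change laxKowZ c F lam (x.1 * expSO (t • X), x.2) a b =
      _ + ((dress p q c lam)⁻¹ * laxLin _ (_ : Matrix (Fin p) (Fin q) ℂ) _ _ : BlockMatrix p q) a b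
    rw [laxKowZ_eq, laxNum_eq, ← Matrix.add_apply, ← Matrix.mul_add]
    rfl
  -- Along `k ↦ k X` the matrix `S = kᵀ F` moves by `Xᵀ S = -X S`, and its transpose by `Sᵀ X`.
  · have hs : symVar (cx ((rot x)ᵀ * F)) (cx (X : Matrix (Fin p) (Fin p) ℝ)) =
        symB (cx ((rot x * (X : Matrix (Fin p) (Fin p) ℝ))ᵀ * F)) := by
      have e : cx ((rot x * (X : Matrix (Fin p) (Fin p) ℝ))ᵀ * F) =
          -(cx (X : Matrix (Fin p) (Fin p) ℝ) * cx ((rot x)ᵀ * F)) := by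
        rw [Matrix.transpose_mul, Matrix.mul_assoc, cx_mul, ← Matrix.neg_mul,
          ← cx_so_transpose X]
        rfl
      rw [e, symVar, symB, Matrix.transpose_neg, Matrix.transpose_mul, cx_so_transpose,
        Matrix.mul_neg, neg_neg]
    rw [laxDRot, rotVar, hs]
    rfl

theorem cx_gen (i j : Fin p) :
    cx ((gen i j : LieAlgebra.Orthogonal.so (Fin p) ℝ) : Matrix (Fin p) (Fin p) ℝ) =
      skewUnit i j := by
  ext x y
  simp only [cx, gen, skewUnit, Matrix.map_apply, Matrix.sub_apply, Matrix.single_apply]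
  push_cast
  split_ifs <;> simp

end Derivatives

/-! ### The r-matrix relation. -/

section RMatrix

variable {p q : ℕ}

/-- For skew `C` the full double sum of generators is `C - Cᵀ = 2 C`; the factor `2` cancels the
`1/2` in `poisson`. -/
theorem momBlock_sum (E : Matrix (Fin p) (Fin q) ℂ) (C : Matrix (Fin p) (Fin p) ℂ)
    (hC : Cᵀ = -C) : ∑ i, ∑ j, C i j • momBlock E (skewUnit i j) = (2 : ℂ) • momBlock E C := by
  let Λ : Matrix (Fin p) (Fin p) ℂ →ₗ[ℂ] BlockMatrix p q :=
    { toFun := momBlock E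
      map_add' := fun X Y => by
        simp only [momBlock, Matrix.fromBlocks_add, Matrix.mul_add, Matrix.add_mul, neg_add,
          add_zero]
      map_smul' := fun t X => by
        simp only [momBlock, Matrix.fromBlocks_smul, Matrix.mul_smul, Matrix.smul_mul, smul_neg,
          smul_zero, RingHom.id_apply] }
  have h := congrArg Λ (sum_smul_skewUnit C)
  rw [hC, sub_neg_eq_add, ← two_smul ℂ C] at h
  simp only [map_sum, map_smul] at h
  exact h

theorem rotVar_sum (c : ℂ) (E S : Matrix (Fin p) (Fin q) ℂ) (lam : ℂ)
    (C : Matrix (Fin p) (Fin p) ℂ) (hC : Cᵀ = -C) :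
    ∑ i, ∑ j, C i j • rotVar c E S lam (skewUnit i j) = (2 : ℂ) • rotVar c E S lam C := by
  have hadd : ∀ X Y : Matrix (Fin p) (Fin p) ℂ,
      symVar S (X + Y) = symVar S X + symVar S Y := fun X Y => by
    simp only [symVar, Matrix.fromBlocks_add, Matrix.mul_add, Matrix.add_mul, neg_add, add_zero]
  have hsmul : ∀ (t : ℂ) (X : Matrix (Fin p) (Fin p) ℂ),
      symVar S (t • X) = t • symVar S X := fun t X => by
    simp only [symVar, Matrix.fromBlocks_smul, Matrix.mul_smul, Matrix.smul_mul, smul_neg,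
      smul_zero]
  let Λ : Matrix (Fin p) (Fin p) ℂ →ₗ[ℂ] BlockMatrix p q :=
    { toFun := rotVar c E S lam
      map_add' := fun X Y => by
        simp only [rotVar, hadd, Matrix.mul_add, Matrix.add_mul]
        module
      map_smul' := fun t X => by
        simp only [rotVar, hsmul, Matrix.mul_smul, Matrix.smul_mul, RingHom.id_apply]
        module }
  have h := congrArg Λ (sum_smul_skewUnit C)
  rw [hC, sub_neg_eq_add, ← two_smul ℂ C] at h
  simp only [map_sum, map_smul] at h
  exact h

theorem trace_momBlock_mul (E : Matrix (Fin p) (Fin q) ℂ) (X : Matrix (Fin p) (Fin p) ℂ)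
    (B : BlockMatrix p q) : (momBlock E X * B).trace = (X * momDual E B).trace := by
  rw [momBlock, trace_fromBlocks_diag_mul, momDual, Matrix.mul_sub, Matrix.trace_sub,
    Matrix.neg_mul, Matrix.trace_neg, trace_sandwich, sub_eq_add_neg]

theorem trace_symVar_mul (S : Matrix (Fin p) (Fin q) ℂ) (X : Matrix (Fin p) (Fin p) ℂ)
    (B : BlockMatrix p q) : (symVar S X * B).trace = (X * symDual S B).trace := by
  rw [symVar, trace_fromBlocks_antidiag_mul, symDual, Matrix.mul_sub, Matrix.trace_sub,
    Matrix.neg_mul, Matrix.trace_neg, Matrix.mul_assoc, Matrix.mul_assoc,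
    Matrix.trace_mul_comm Sᵀ, Matrix.mul_assoc]
  ring

theorem trace_rotVar_mul (c : ℂ) (E S : Matrix (Fin p) (Fin q) ℂ) (mu : ℂ)
    (X : Matrix (Fin p) (Fin p) ℂ) (B : BlockMatrix p q) :
    (rotVar c E S mu X * B).trace = (X * rotDual c E S mu B).trace := by
  have h : ∀ Z Y : BlockMatrix p q, ((Z * Y + Y * Z) * B).trace = (Y * (B * Z + Z * B)).trace := by
    intro Z Y
    rw [Matrix.add_mul, Matrix.mul_add, Matrix.trace_add, Matrix.trace_add, Matrix.mul_assoc,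
      Matrix.trace_mul_comm Z, Matrix.mul_assoc, Matrix.mul_assoc]
  rw [rotVar, rotDual, Matrix.sub_mul, Matrix.trace_sub, Matrix.smul_mul, Matrix.trace_smul,
    Matrix.smul_mul, Matrix.trace_smul, h, trace_symVar_mul, trace_symVar_mul, Matrix.mul_sub,
    Matrix.trace_sub, Matrix.mul_smul, Matrix.trace_smul, Matrix.mul_smul, Matrix.trace_smul]

/-- The structure functions contracted with a skew matrix give the coadjoint action, that is, a
commutator with `ℓ`. The `2` again counts each pair twice. -/
theorem sum_structureFun_mul (l : Matrix (Fin p) (Fin p) ℝ) (hl : lᵀ = -l)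
    (w : Matrix (Fin p) (Fin p) ℂ) (hw : wᵀ = -w) (i j : Fin p) :
    ∑ m, ∑ n, (structureFun l i j m n : ℂ) * w m n =
      -2 * (cx l * w - w * cx l) i j := by
  have hl' : ∀ a b, (l a b : ℂ) = -(l b a : ℂ) := fun a b => by
    have := congrFun (congrFun hl b) a
    simp only [Matrix.transpose_apply, Matrix.neg_apply] at this
    rw [this]; simp
  have hw' : ∀ a b, w a b = -w b a := fun a b => congrFun (congrFun hw b) a
  have h : ∀ m n, (structureFun l i j m n : ℂ) * w m n =
      (if i = n then (l j m : ℂ) * w m n else 0) + (if j = m then (l i n : ℂ) * w m n else 0)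
      - (if i = m then (l j n : ℂ) * w m n else 0)
      - (if j = n then (l i m : ℂ) * w m n else 0) := by
    intro m n
    unfold structureFun
    split_ifs <;> push_cast <;> ring
  simp only [h, Finset.sum_add_distrib, Finset.sum_sub_distrib, Finset.sum_ite_irrel,
    Finset.sum_const_zero, Finset.sum_ite_eq, Finset.mem_univ, if_true, Matrix.sub_apply,
    Matrix.mul_apply, mul_sub, Finset.mul_sum]
  simp only [← Finset.sum_add_distrib, ← Finset.sum_sub_distrib]
  refine Finset.sum_congr rfl fun k _ => ?_
  simp only [cx, Matrix.map_apply]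
  rw [hw' i k, hw' j k, hl' j k]
  ring

theorem tensorBracket_eq_sum (A A' : Phase p → BlockMatrix p q) (x : Phase p)
    (U V U' V' : Fin p → Fin p → BlockMatrix p q)
    (hU : ∀ i j a b, dMom (gen i j) (fun y => A y a b) x = U i j a b)
    (hV : ∀ i j a b, dRot (gen i j) (fun y => A y a b) x = V i j a b)
    (hU' : ∀ i j a b, dMom (gen i j) (fun y => A' y a b) x = U' i j a b)
    (hV' : ∀ i j a b, dRot (gen i j) (fun y => A' y a b) x = V' i j a b) :
    tensorBracket A A' x =
      (1 / 2 : ℂ) • ∑ i, ∑ j, (U i j ⊗ₖ V' i j - V i j ⊗ₖ U' i j)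
      + (1 / 4 : ℂ) • ∑ i, ∑ j, ∑ m, ∑ n,
        (structureFun (mom x) i j m n : ℂ) • (U i j ⊗ₖ U' m n) := by
  ext a b
  simp only [tensorBracket, poisson, hU, hV, hU', hV', Matrix.of_apply, Matrix.add_apply,
    Matrix.smul_apply, Matrix.sum_apply, Matrix.sub_apply, Matrix.kroneckerMap_apply,
    smul_eq_mul, mul_assoc]

theorem dMom_laxKowZ (c : ℂ) (F : Matrix (Fin p) (Fin q) ℝ) (lam : ℂ) (x : Phase p)
    (i j : Fin p) (a b : Fin p ⊕ Fin q) :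
    dMom (gen i j) (fun y => laxKowZ c F lam y a b) x = laxDMom q c lam (skewUnit i j) a b := by
  rw [← cx_gen]
  exact (hasDerivAt_laxKowZ_mom c F lam x (gen i j) a b).deriv

theorem dRot_laxKowZ (c : ℂ) (F : Matrix (Fin p) (Fin q) ℝ) (lam : ℂ) (x : Phase p)
    (i j : Fin p) (a b : Fin p ⊕ Fin q) :
    dRot (gen i j) (fun y => laxKowZ c F lam y a b) x =
      laxDRot c F lam x (skewUnit i j) a b := by
  rw [← cx_gen]
  exact (hasDerivAt_laxKowZ_rot c F lam x (gen i j) a b).deriv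

theorem mom_transpose (x : Phase p) : (mom x)ᵀ = -mom x :=
  (LieAlgebra.Orthogonal.mem_so _ _ _).1 x.2.2

/-- The factor `N(μ)` in the test matrix cancels the constant `N(μ)⁻¹` of the second Lax matrix by
cyclicity; the remaining traces are moved to the dual maps, and the sums over generators collapse to
the three terms of `bracketNum`. -/
theorem contract_tensorBracket (c : ℂ) (F : Matrix (Fin p) (Fin q) ℝ) (lam mu : ℂ)
    (hmu : IsUnit (dress p q c mu).det) (x : Phase p) (B : BlockMatrix p q) :
    contract (B * dress p q c mu) (tensorBracket (laxKowZ c F lam) (laxKowZ c F mu) x) =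
      (dress p q c lam)⁻¹ * bracketNum c (cx (truncId p q)) (cx ((rot x)ᵀ * F)) (cx (mom x))
        lam mu B := by
  have htr : ∀ X : BlockMatrix p q,
      ((dress p q c mu)⁻¹ * X * (B * dress p q c mu)).trace = (X * B).trace := by
    intro X
    rw [Matrix.mul_assoc, Matrix.trace_mul_comm, Matrix.mul_assoc, Matrix.mul_assoc,
      Matrix.mul_nonsing_inv _ hmu, Matrix.mul_one]
  set u := momDual (cx (truncId p q)) B with hu
  set v := rotDual c (cx (truncId p q)) (cx ((rot x)ᵀ * F)) mu B with hv
  have hu1 : ∀ i j, (laxDMom q c mu (skewUnit i j) * (B * dress p q c mu)).trace =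
      -(uᵀ - u) i j := by
    intro i j
    rw [laxDMom, htr, Matrix.neg_mul, Matrix.trace_neg, trace_momBlock_mul, trace_skewUnit_mul]
    rfl
  have hv1 : ∀ i j, (laxDRot c F mu x (skewUnit i j) * (B * dress p q c mu)).trace =
      (vᵀ - v) i j := by
    intro i j
    rw [laxDRot, htr, trace_rotVar_mul, trace_skewUnit_mul]
    rfl
  have hw : ∀ u : Matrix (Fin p) (Fin p) ℂ, (uᵀ - u)ᵀ = -(uᵀ - u) := fun u => by
    rw [Matrix.transpose_sub, Matrix.transpose_transpose, neg_sub]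
  have hlx : (cx (mom x))ᵀ = -cx (mom x) := cx_so_transpose x.2
  have hlw : (cx (mom x) * (uᵀ - u) - (uᵀ - u) * cx (mom x))ᵀ =
      -(cx (mom x) * (uᵀ - u) - (uᵀ - u) * cx (mom x)) := by
    rw [Matrix.transpose_sub, Matrix.transpose_mul, Matrix.transpose_mul, hw, hlx]
    noncomm_ring
  rw [tensorBracket_eq_sum _ _ x _ _ _ _ (dMom_laxKowZ c F lam x) (dRot_laxKowZ c F lam x)
    (dMom_laxKowZ c F mu x) (dRot_laxKowZ c F mu x)]
  simp only [map_add, map_smul, map_sum, map_sub, contract_kronecker, hu1, hv1, smul_smul,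
    ← Finset.sum_smul, mul_neg, Finset.sum_neg_distrib,
    sum_structureFun_mul (mom x) (mom_transpose x) (uᵀ - u) (hw u)]
  simp only [laxDMom, laxDRot, Finset.sum_sub_distrib, neg_smul, Finset.sum_neg_distrib,
    ← Matrix.mul_smul, ← Matrix.mul_sum, smul_neg, mul_smul, ← Finset.smul_sum,
    momBlock_sum _ _ (hw v), momBlock_sum _ _ hlw, rotVar_sum _ _ _ _ _ (hw u)]
  rw [bracketNum, ← hu, ← hv]
  simp only [Matrix.mul_add, Matrix.mul_sub, Matrix.mul_neg, Matrix.mul_smul]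
  module

theorem permOp_mul_permOp : (permOp : TensorMatrix p q) * permOp = 1 := by
  have h := permOp_mul_kronecker_mul (1 : BlockMatrix p q) 1
  rwa [Matrix.one_kronecker_one, Matrix.mul_one] at h

theorem permOp_mul_mul_mul (T T' : TensorMatrix p q) :
    permOp * (T * T') * permOp = permOp * T * permOp * (permOp * T' * permOp) := by
  have h : ∀ X : TensorMatrix p q, permOp * (permOp * X) = X := fun X => by
    rw [← Matrix.mul_assoc, permOp_mul_permOp, Matrix.one_mul]
  simp only [Matrix.mul_assoc, h]

theorem rBody_eq {lam mu : ℂ} (hlam : lam ≠ 0) (hmu : mu ≠ 0) (hne : lam ^ 2 ≠ mu ^ 2) :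
    (rBody lam mu : TensorMatrix p q) = (mu ^ 2 / (mu ^ 2 - lam ^ 2)) • casimirF
      + (-(lam * mu / (mu ^ 2 - lam ^ 2))) • casimirP := by
  have h1 : mu ^ 2 - lam ^ 2 ≠ 0 := sub_ne_zero.2 (Ne.symm hne)
  have h2 : lam⁻¹ ^ 2 - mu⁻¹ ^ 2 = (mu ^ 2 - lam ^ 2) / (lam ^ 2 * mu ^ 2) := by
    field_simp
  rw [rBody, rKernel, h2, neg_add, ← neg_smul, ← neg_smul]
  congr 2
  · field_simp
  · field_simp

theorem contract_rBody {lam mu : ℂ} (hlam : lam ≠ 0) (hmu : mu ≠ 0) (hne : lam ^ 2 ≠ mu ^ 2)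
    (B : BlockMatrix p q) : contract B (rBody lam mu) =
      contrR (mu ^ 2 / (mu ^ 2 - lam ^ 2)) (-(lam * mu / (mu ^ 2 - lam ^ 2))) B := by
  rw [rBody_eq hlam hmu hne, map_add, map_smul, map_smul, contract_casimirF, contract_casimirP,
    contrR]

theorem permOp_mul_rBody_mul (lam mu : ℂ) :
    permOp * (rBody lam mu : TensorMatrix p q) * permOp = rBody lam mu := by
  rw [rBody, rKernel, Matrix.mul_neg, Matrix.neg_mul, Matrix.mul_add, Matrix.add_mul,
    Matrix.mul_smul, Matrix.smul_mul, permOp_mul_casimirF_mul, Matrix.mul_smul, Matrix.smul_mul,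
    permOp_mul_casimirP_mul]

theorem contract_rKowZ (c lam mu : ℂ) (hmu : IsUnit (dress p q c mu).det)
    (B : BlockMatrix p q) :
    contract (B * dress p q c mu) (rKowZ c lam mu) =
      contract B (rBody lam mu) * dress p q c lam - contrH (cx (truncId p q)) B := by
  change contract _ (((1 : BlockMatrix p q) ⊗ₖ (dress p q c mu)⁻¹) *
    (rBody lam mu * (dress p q c lam ⊗ₖ (1 : BlockMatrix p q)) - hatSum)) = _
  rw [contract_snd_mul, Matrix.mul_assoc, Matrix.mul_nonsing_inv _ hmu, Matrix.mul_one, map_sub,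
    contract_mul_fst, contract_hatSum]

theorem contract_flipKernel_rKowZ (c lam mu : ℂ) (B : BlockMatrix p q) :
    contract B (flipKernel (rKowZ c) lam mu) = (dress p q c lam)⁻¹ *
      (contract (dress p q c mu * B) (rBody mu lam) - contrHFlip (cx (truncId p q)) B) := by
  change contract _ (permOp * (((1 : BlockMatrix p q) ⊗ₖ (dress p q c lam)⁻¹) *
    (rBody mu lam * (dress p q c mu ⊗ₖ (1 : BlockMatrix p q)) - hatSum)) * permOp) = _
  rw [permOp_mul_mul_mul, permOp_mul_kronecker_mul, contract_fst_mul, Matrix.mul_sub,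
    Matrix.sub_mul, permOp_mul_mul_mul, permOp_mul_kronecker_mul, permOp_mul_rBody_mul, map_sub,
    contract_mul_snd, contract_flip_hatSum]

/-- `contrH` takes values in the matrices `diag(E Y Eᵀ, Y)`, and these commute with `z̃` because `Eᵀ
E = 1`. -/
theorem contrH_mul_dress (hqp : q ≤ p) (c lam : ℂ) (B : BlockMatrix p q) :
    contrH (cx (truncId p q)) B * dress p q c lam =
      dress p q c lam * contrH (cx (truncId p q)) B := by
  have hE := truncId_transpose_mul_truncId hqp
  have h : contrH (cx (truncId p q)) B * skewB c (cx (truncId p q)) =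
      skewB c (cx (truncId p q)) * contrH (cx (truncId p q)) B := by
    have hE' : (cx (truncId p q))ᵀ * (cx (truncId p q) *
        ((B.toBlocks₂₂ᵀ - B.toBlocks₂₂) * (cx (truncId p q))ᵀ)) =
        (B.toBlocks₂₂ᵀ - B.toBlocks₂₂) * (cx (truncId p q))ᵀ := by
      rw [← Matrix.mul_assoc, hE, Matrix.one_mul]
    simp only [contrH, skewB, Matrix.mul_smul, Matrix.smul_mul, Matrix.fromBlocks_multiply,
      Matrix.mul_zero, Matrix.zero_mul, add_zero, zero_add, Matrix.mul_neg, Matrix.neg_mul,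
      Matrix.mul_assoc, hE, hE', Matrix.mul_one, neg_zero]
  rw [dress_eq, Matrix.mul_sub, Matrix.sub_mul, Matrix.mul_smul, Matrix.smul_mul, h,
    Matrix.mul_one, Matrix.one_mul]

theorem contrHFlip_sub (E : Matrix (Fin p) (Fin q) ℂ) (B C : BlockMatrix p q) :
    contrHFlip E (B - C) = contrHFlip E B - contrHFlip E C := by
  have h1 : (B - C).toBlocks₁₁ = B.toBlocks₁₁ - C.toBlocks₁₁ := rfl
  have h2 : (B - C).toBlocks₂₂ = B.toBlocks₂₂ - C.toBlocks₂₂ := rfl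
  simp only [contrHFlip, h1, h2, fromBlocks_sub, Matrix.transpose_sub, sub_zero, Matrix.mul_sub,
    Matrix.sub_mul]
  congr 1
  abel

/-- Dual to the commutation of `contrH` with `z̃`: `contrHFlip` is the transpose of `contrH` for the
trace form, so it annihilates commutators with `z̃`. -/
theorem contrHFlip_mul_dress (hqp : q ≤ p) (c mu : ℂ) (B : BlockMatrix p q) :
    contrHFlip (cx (truncId p q)) (B * dress p q c mu) =
      contrHFlip (cx (truncId p q)) (dress p q c mu * B) := by
  have hE := truncId_transpose_mul_truncId hqp
  rw [← sub_eq_zero, ← contrHFlip_sub, dress_eq, Matrix.mul_sub, Matrix.sub_mul, Matrix.mul_smul,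
    Matrix.smul_mul, Matrix.mul_one, Matrix.one_mul, sub_sub_sub_cancel_left]
  set E := cx (truncId p q)
  have hE1 : ∀ X : Matrix (Fin q) (Fin q) ℂ, Eᵀ * (E * X) = X := fun X => by
    rw [← Matrix.mul_assoc, hE, Matrix.one_mul]
  obtain ⟨b₁, b₂, b₃, b₄, rfl⟩ : ∃ b₁ b₂ b₃ b₄, B = Matrix.fromBlocks b₁ b₂ b₃ b₄ :=
    ⟨_, _, _, _, (Matrix.fromBlocks_toBlocks B).symm⟩
  simp only [contrHFlip, skewB, Matrix.fromBlocks_smul, Matrix.fromBlocks_multiply,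
    fromBlocks_sub, Matrix.toBlocks_fromBlocks₁₁, Matrix.toBlocks_fromBlocks₂₂, smul_zero,
    Matrix.mul_zero, Matrix.zero_mul, add_zero, zero_add]
  simp only [Matrix.transpose_sub, Matrix.transpose_neg,
    Matrix.transpose_mul, Matrix.transpose_smul, Matrix.transpose_transpose,
    Matrix.mul_sub, Matrix.sub_mul, Matrix.mul_neg, Matrix.neg_mul,
    Matrix.mul_smul, Matrix.smul_mul, Matrix.mul_assoc, hE, hE1, Matrix.mul_one]
  rw [← Matrix.fromBlocks_zero]
  congr 1
  module

theorem contrR_sub (a b : ℂ) (B C : BlockMatrix p q) :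
    contrR a b (B - C) = contrR a b B - contrR a b C := by
  rw [contrR, contrR, contrR, ← contract_casimirF, ← contract_casimirP, ← contract_casimirF,
    ← contract_casimirP, ← contract_casimirF, ← contract_casimirP]
  have h : ∀ T : TensorMatrix p q, contract (B - C) T = contract B T - contract C T := fun T => by
    ext x y
    simp [contract_apply, mul_sub, Finset.sum_sub_distrib]
  rw [h, h]
  module

theorem rMatrixRelation_laxKowZ (hqp : q ≤ p) (F : Matrix (Fin p) (Fin q) ℝ) (c lam mu : ℂ)
    (hlam : lam ∈ domainKowZ p q c) (hmu : mu ∈ domainKowZ p q c) (hne : lam ^ 2 ≠ mu ^ 2) :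
    RMatrixRelation (laxKowZ c F) (rKowZ c) lam mu := by
  intro x
  have ul : IsUnit (dress p q c lam).det := isUnit_iff_ne_zero.2 hlam.2
  have um : IsUnit (dress p q c mu).det := isUnit_iff_ne_zero.2 hmu.2
  have hlx : (cx (mom x))ᵀ = -cx (mom x) := cx_so_transpose x.2
  refine ext_contract fun B' => ?_
  -- Since `N(μ)` is invertible, matrices of the form `B N(μ)` exhaust all test matrices.
  obtain ⟨B, rfl⟩ : ∃ B, B' = B * dress p q c mu :=
    ⟨B' * (dress p q c mu)⁻¹, by rw [Matrix.mul_assoc, Matrix.nonsing_inv_mul _ um,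
      Matrix.mul_one]⟩
  rw [contract_tensorBracket c F lam mu um x B, bracketNum_eq _ _ _ _ _ _ _
    (truncId_transpose_mul_truncId hqp) hlx hlam.1 hmu.1 hne]
  simp only [← dress_eq]
  rw [Ring.lie_def, Ring.lie_def, map_neg, map_sub, map_sub, map_sub, contract_mul_fst,
    contract_fst_mul, contract_mul_snd, contract_snd_mul, contract_rKowZ c lam mu um,
    contract_flipKernel_rKowZ, contract_flipKernel_rKowZ, contract_rBody hlam.1 hmu.1 hne,
    contract_rBody hmu.1 hlam.1 (Ne.symm hne), contract_rBody hmu.1 hlam.1 (Ne.symm hne),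
    laxKowZ_eq, laxKowZ_eq, contrR_sub, contrHFlip_sub, mul_comm mu lam]
  set Nl := dress p q c lam
  set Nm := dress p q c mu
  set Ll := laxNum c (cx (truncId p q)) (cx ((rot x)ᵀ * F)) (cx (mom x)) lam
  set Lm := laxNum c (cx (truncId p q)) (cx ((rot x)ᵀ * F)) (cx (mom x)) mu
  have e1 : Nm * (Nm⁻¹ * Lm * (B * Nm)) = Lm * B * Nm := by
    simp only [← Matrix.mul_assoc, Nm, Matrix.mul_nonsing_inv _ um, Matrix.one_mul]
  have e2 : Nm * (B * Nm * (Nm⁻¹ * Lm)) = Nm * B * Lm := by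
    simp only [Matrix.mul_assoc]
    rw [← Matrix.mul_assoc Nm Nm⁻¹, Matrix.mul_nonsing_inv _ um, Matrix.one_mul]
  have e3 : B * Nm * (Nm⁻¹ * Lm) = B * Lm := by
    rw [Matrix.mul_assoc, ← Matrix.mul_assoc Nm Nm⁻¹, Matrix.mul_nonsing_inv _ um, Matrix.one_mul]
  have e4 : contrHFlip (cx (truncId p q)) (Nm⁻¹ * Lm * (B * Nm)) =
      contrHFlip (cx (truncId p q)) (Lm * B) := by
    rw [← Matrix.mul_assoc, contrHFlip_mul_dress hqp, ← Matrix.mul_assoc, ← Matrix.mul_assoc,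
      Matrix.mul_nonsing_inv _ um, Matrix.one_mul]
  rw [e1, e2, e3, e4]
  have e5 : contrH (cx (truncId p q)) B * Nl⁻¹ = Nl⁻¹ * contrH (cx (truncId p q)) B := by
    have h := congrArg (fun Y => Nl⁻¹ * Y * Nl⁻¹) (contrH_mul_dress hqp c lam B)
    simp only [Matrix.mul_assoc] at h
    rwa [Matrix.mul_nonsing_inv _ ul, Matrix.mul_one, ← Matrix.mul_assoc Nl⁻¹ Nl,
      Matrix.nonsing_inv_mul _ ul, Matrix.one_mul, eq_comm] at h
  have e6 : ∀ Y : BlockMatrix p q, Nl⁻¹ * (Nl * Y) = Y := fun Y => by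
    rw [← Matrix.mul_assoc, Matrix.nonsing_inv_mul _ ul, Matrix.one_mul]
  have e7 : ∀ Y : BlockMatrix p q, Nl * (Nl⁻¹ * Y) = Y := fun Y => by
    rw [← Matrix.mul_assoc, Matrix.mul_nonsing_inv _ ul, Matrix.one_mul]
  have e8 : ∀ Y : BlockMatrix p q, contrH (cx (truncId p q)) B * (Nl⁻¹ * Y) =
      Nl⁻¹ * (contrH (cx (truncId p q)) B * Y) := fun Y => by
    rw [← Matrix.mul_assoc, e5, Matrix.mul_assoc]
  simp only [Matrix.mul_add, Matrix.mul_sub, Matrix.sub_mul, Matrix.mul_neg, Matrix.mul_assoc,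
    e6, e7, e8]
  abel

theorem rKowZ_zero (lam mu : ℂ) : (rKowZ 0 lam mu : TensorMatrix p q) = rKow lam mu := by
  simp [rKowZ, rKow, zTilde]

theorem laxKowZ_zero (F : Matrix (Fin p) (Fin q) ℝ) : laxKowZ 0 F = laxKow F := by
  funext lam x
  simp [laxKowZ, laxKow, laxBodyZ, zTilde]

theorem domainKowZ_zero : domainKowZ p q 0 = domainKow := by
  simp [domainKowZ, domainKow, zTilde]

end RMatrix

/-! ### Gradients of spectral functions. -/

section Spectral

variable {N : Type} [Fintype N]

/-- `G` is a gradient of the function `φ` of a matrix with respect to the trace form, and it is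
continuous and commutes with its argument. -/
structure IsSpectralGradient (φ : Matrix N N ℂ → ℂ) (G : Matrix N N ℂ → Matrix N N ℂ) : Prop where
  continuous : Continuous G
  commute : ∀ A, G A * A = A * G A
  hasDerivAt : ∀ (A : ℝ → Matrix N N ℂ) (A' : Matrix N N ℂ) (t : ℝ),
    (∀ a b, HasDerivAt (fun s => A s a b) (A' a b) t) →
      HasDerivAt (fun s => φ (A s)) (G (A t) * A').trace t

theorem IsSpectralGradient.sum {ι : Type} (s : Finset ι) (w : ι → ℂ)
    {φ : ι → Matrix N N ℂ → ℂ} {G : ι → Matrix N N ℂ → Matrix N N ℂ}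
    (h : ∀ i, IsSpectralGradient (φ i) (G i)) :
    IsSpectralGradient (fun A => ∑ i ∈ s, φ i A * w i) (fun A => ∑ i ∈ s, w i • G i A) where
  continuous := continuous_finsetSum _ fun i _ => (h i).continuous.const_smul (w i)
  commute A := by
    simp only [Matrix.sum_mul, Matrix.mul_sum, Matrix.smul_mul, Matrix.mul_smul, (h _).commute]
  hasDerivAt A A' t hA := by
    simp only [Matrix.sum_mul, Matrix.trace_sum, Matrix.smul_mul, Matrix.trace_smul, smul_eq_mul]
    exact HasDerivAt.fun_sum fun i _ => by
      rw [mul_comm]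
      exact ((h i).hasDerivAt A A' t hA).mul_const _

theorem hasDerivAt_matrix_mul {A B : ℝ → Matrix N N ℂ} {A' B' : Matrix N N ℂ} {t : ℝ}
    (hA : ∀ a b, HasDerivAt (fun s => A s a b) (A' a b) t)
    (hB : ∀ a b, HasDerivAt (fun s => B s a b) (B' a b) t) (a b : N) :
    HasDerivAt (fun s => (A s * B s) a b) ((A' * B t + A t * B') a b) t := by
  simp only [Matrix.mul_apply, Matrix.add_apply, ← Finset.sum_add_distrib]
  exact HasDerivAt.fun_sum fun k _ => (hA a k).mul (hB k b)

variable [DecidableEq N]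

/-- The derivative of `Aⁿ` is a sum of `n` words with one letter `A'`; against a matrix commuting
with `A` they all have the same trace. The commuting `C` is carried along so that the induction
closes. -/
theorem exists_hasDerivAt_matrix_pow {A : ℝ → Matrix N N ℂ} {A' : Matrix N N ℂ} {t : ℝ}
    (hA : ∀ a b, HasDerivAt (fun s => A s a b) (A' a b) t) (n : ℕ) :
    ∃ D : Matrix N N ℂ, (∀ a b, HasDerivAt (fun s => (A s ^ n) a b) (D a b) t) ∧
      ∀ C : Matrix N N ℂ, C * A t = A t * C →
        (C * D).trace = (n : ℂ) * (C * A t ^ (n - 1) * A').trace := by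
  induction n with
  | zero =>
    refine ⟨0, fun a b => ?_, fun C _ => by simp⟩
    simp only [pow_zero]
    exact hasDerivAt_const _ _
  | succ n ih =>
    obtain ⟨D, hD, hC⟩ := ih
    refine ⟨D * A t + A t ^ n * A', fun a b => ?_, fun C h => ?_⟩
    · simp only [pow_succ]
      exact hasDerivAt_matrix_mul hD hA a b
    · have h1 : (C * (D * A t)).trace = ((A t * C) * D).trace := by
        rw [← Matrix.mul_assoc, Matrix.trace_mul_comm, Matrix.mul_assoc]
      rw [Matrix.mul_add, Matrix.trace_add, h1, hC (A t * C) (by rw [Matrix.mul_assoc, h])]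
      -- The exponent `n - 1` is truncated at `n = 0`, where its coefficient vanishes.
      rcases n with _ | n
      · simp
      · have h2 : A t * C * A t ^ (n + 1 - 1) = C * A t ^ (n + 1) := by
          rw [← h, Matrix.mul_assoc, Nat.add_sub_cancel, ← pow_succ']
        rw [h2, ← Matrix.mul_assoc, Nat.add_sub_cancel]
        push_cast
        ring

theorem isSpectralGradient_trace_pow (n : ℕ) :
    IsSpectralGradient (fun A : Matrix N N ℂ => (A ^ n).trace)
      (fun A => (n : ℂ) • A ^ (n - 1)) where
  continuous := (continuous_id.pow (n - 1)).const_smul (n : ℂ)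
  commute A := by
    rw [Matrix.smul_mul, Matrix.mul_smul, ← pow_succ, ← pow_succ']
  hasDerivAt A A' t hA := by
    obtain ⟨D, hD, hC⟩ := exists_hasDerivAt_matrix_pow hA n
    have h := hC 1 (by rw [Matrix.one_mul, Matrix.mul_one])
    rw [Matrix.one_mul, Matrix.one_mul] at h
    rw [Matrix.smul_mul, Matrix.trace_smul, smul_eq_mul, ← h]
    exact HasDerivAt.fun_sum fun a _ => hD a a

/-- Jacobi's formula: the determinant is multilinear in the rows, and Cramer's rule turns each
determinant with one row replaced into a row of `A'` paired with the adjugate. -/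
theorem hasDerivAt_det {A : ℝ → Matrix N N ℂ} {A' : Matrix N N ℂ} {t : ℝ}
    (hA : ∀ a b, HasDerivAt (fun s => A s a b) (A' a b) t) :
    HasDerivAt (fun s => (A s).det) ((A t).adjugate * A').trace t := by
  let f : ContinuousMultilinearMap ℂ (fun _ : N => N → ℂ) ℂ :=
    { toMultilinearMap := (Matrix.detRowAlternating (n := N) (R := ℂ)).toMultilinearMap
      cont := Continuous.matrix_det (A := fun M : N → N → ℂ => Matrix.of M) continuous_id }
  have h1 : HasDerivAt (fun s a b => A s a b) (fun a b => A' a b) t :=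
    hasDerivAt_pi.2 fun a => hasDerivAt_pi.2 fun b => hA a b
  have h2 := ((f.restrictScalars ℝ).hasFDerivAt (fun a b => A t a b)).comp_hasDerivAt t h1
  refine h2.congr_deriv ?_
  rw [ContinuousMultilinearMap.linearDeriv_apply, Matrix.trace_mul_comm, Matrix.trace]
  refine Finset.sum_congr rfl fun i _ => ?_
  change ((A t).updateRow i (A' i)).det = _
  rw [← Matrix.cramer_transpose_apply, Matrix.cramer_eq_adjugate_mulVec, ← Matrix.adjugate_transpose,
    Matrix.mulVec_transpose]
  rfl

theorem isSpectralGradient_det_sub (z : ℂ) :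
    IsSpectralGradient (fun A : Matrix N N ℂ => (Matrix.scalar N z - A).det)
      (fun A => -(Matrix.scalar N z - A).adjugate) where
  continuous := (Continuous.matrix_adjugate (continuous_const.sub continuous_id)).neg
  commute A := by
    have h := (Matrix.adjugate_mul (Matrix.scalar N z - A)).trans
      (Matrix.mul_adjugate (Matrix.scalar N z - A)).symm
    have hz : Matrix.scalar N z * (Matrix.scalar N z - A).adjugate =
        (Matrix.scalar N z - A).adjugate * Matrix.scalar N z :=
      (Matrix.scalar_commute z (fun _ => Commute.all _ _) _).eq
    rw [Matrix.mul_sub, Matrix.sub_mul, hz] at h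
    rw [Matrix.neg_mul, Matrix.mul_neg, sub_right_injective h]
  hasDerivAt A A' t hA := by
    have h := hasDerivAt_det (A := fun s => Matrix.scalar N z - A s) (A' := -A') (t := t)
      fun a b => (hA a b).const_sub _
    rwa [Matrix.mul_neg, ← Matrix.neg_mul] at h

/-- Lagrange interpolation makes each coefficient a fixed linear combination of the values `det(z -
A)` at finitely many `z`, whose gradients are adjugates. -/
theorem exists_isSpectralGradient_charpoly_coeff (k : ℕ) :
    ∃ G, IsSpectralGradient (fun A : Matrix N N ℂ => A.charpoly.coeff k) G := by
  -- One node more than the degree of the characteristic polynomial.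
  let v : Fin (Fintype.card N + 1) → ℂ := fun i => (i : ℕ)
  have hv : Set.InjOn v (Finset.univ : Finset (Fin (Fintype.card N + 1))) := by
    intro i _ j _ h
    exact Fin.ext (Nat.cast_injective h)
  have h : ∀ A : Matrix N N ℂ, A.charpoly.coeff k =
      ∑ i, (Matrix.scalar N (v i) - A).det * (Lagrange.basis Finset.univ v i).coeff k := by
    intro A
    have hd : A.charpoly.degree <
        (Finset.univ : Finset (Fin (Fintype.card N + 1))).card := by
      rw [Matrix.charpoly_degree_eq_dim, Finset.card_univ, Fintype.card_fin]
      exact_mod_cast Nat.lt_succ_self _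
    conv_lhs => rw [Lagrange.eq_interpolate hv hd, Lagrange.interpolate_apply]
    simp only [Polynomial.finsetSum_coeff, Polynomial.coeff_C_mul, Matrix.eval_charpoly]
  rw [funext h]
  exact ⟨_, IsSpectralGradient.sum _ _ fun i => isSpectralGradient_det_sub (v i)⟩

end Spectral

/-! ### Antisymmetry and the Leibniz rule for the bracket. -/

section Leibniz

variable {p : ℕ}

/-- Observables that have all directional derivatives. -/
def HasDerivatives (f : Phase p → ℂ) : Prop :=
  ∀ (X : LieAlgebra.Orthogonal.so (Fin p) ℝ) (x : Phase p),
    DifferentiableAt ℝ (fun t : ℝ => f (x.1, x.2 + t • X)) 0 ∧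
      DifferentiableAt ℝ (fun t : ℝ => f (x.1 * expSO (t • X), x.2)) 0

theorem hasDerivatives_const (r : ℂ) : HasDerivatives (fun _ : Phase p => r) := fun _ _ =>
  ⟨differentiableAt_const _, differentiableAt_const _⟩

theorem HasDerivatives.add {f g : Phase p → ℂ} (hf : HasDerivatives f) (hg : HasDerivatives g) :
    HasDerivatives (f + g) := fun X x =>
  ⟨(hf X x).1.add (hg X x).1, (hf X x).2.add (hg X x).2⟩

theorem HasDerivatives.mul {f g : Phase p → ℂ} (hf : HasDerivatives f) (hg : HasDerivatives g) :
    HasDerivatives (f * g) := fun X x =>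
  ⟨(hf X x).1.mul (hg X x).1, (hf X x).2.mul (hg X x).2⟩

theorem expSO_zero_smul (X : LieAlgebra.Orthogonal.so (Fin p) ℝ) :
    expSO ((0 : ℝ) • X) = 1 := by
  apply Subtype.ext
  simp [expSO]

theorem dMom_add {f g : Phase p → ℂ} (hf : HasDerivatives f) (hg : HasDerivatives g)
    (X : LieAlgebra.Orthogonal.so (Fin p) ℝ) (x : Phase p) :
    dMom X (f + g) x = dMom X f x + dMom X g x :=
  deriv_add (hf X x).1 (hg X x).1

theorem dRot_add {f g : Phase p → ℂ} (hf : HasDerivatives f) (hg : HasDerivatives g)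
    (X : LieAlgebra.Orthogonal.so (Fin p) ℝ) (x : Phase p) :
    dRot X (f + g) x = dRot X f x + dRot X g x :=
  deriv_add (hf X x).2 (hg X x).2

theorem dMom_mul {f g : Phase p → ℂ} (hf : HasDerivatives f) (hg : HasDerivatives g)
    (X : LieAlgebra.Orthogonal.so (Fin p) ℝ) (x : Phase p) :
    dMom X (f * g) x = dMom X f x * g x + f x * dMom X g x := by
  have h := deriv_mul (hf X x).1 (hg X x).1
  simp only [zero_smul, add_zero] at h
  exact h

theorem dRot_mul {f g : Phase p → ℂ} (hf : HasDerivatives f) (hg : HasDerivatives g)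
    (X : LieAlgebra.Orthogonal.so (Fin p) ℝ) (x : Phase p) :
    dRot X (f * g) x = dRot X f x * g x + f x * dRot X g x := by
  have h := deriv_mul (hf X x).2 (hg X x).2
  simp only [expSO_zero_smul, mul_one] at h
  exact h

theorem dMom_const (X : LieAlgebra.Orthogonal.so (Fin p) ℝ) (r : ℂ) (x : Phase p) :
    dMom X (fun _ => r) x = 0 := deriv_const _ _

theorem dRot_const (X : LieAlgebra.Orthogonal.so (Fin p) ℝ) (r : ℂ) (x : Phase p) :
    dRot X (fun _ => r) x = 0 := deriv_const _ _

theorem structureFun_swap (x : Phase p) (i j m n : Fin p) :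
    structureFun (mom x) m n i j = -structureFun (mom x) i j m n := by
  have h : ∀ a b, mom x a b = -mom x b a := fun a b => by
    have := congrFun (congrFun (mom_transpose x) b) a
    simpa using this
  unfold structureFun
  rw [h j m, h i n, h j n, h i m]
  simp only [eq_comm (a := m), eq_comm (a := n)]
  split_ifs <;> ring

theorem poisson_swap (f g : Phase p → ℂ) : poisson g f = -poisson f g := by
  funext x
  have h : ∀ i j, ∑ m, ∑ n, (structureFun (mom x) i j m n : ℂ) * dMom (gen i j) g x
      * dMom (gen m n) f x = -∑ m, ∑ n, (structureFun (mom x) m n i j : ℂ)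
      * dMom (gen m n) f x * dMom (gen i j) g x := by
    intro i j
    simp only [← Finset.sum_neg_distrib]
    refine Finset.sum_congr rfl fun m _ => Finset.sum_congr rfl fun n _ => ?_
    rw [structureFun_swap x i j m n]
    push_cast
    ring
  have h' : ∑ i, ∑ j, ∑ m, ∑ n, (structureFun (mom x) m n i j : ℂ)
      * dMom (gen m n) f x * dMom (gen i j) g x = ∑ i, ∑ j, ∑ m, ∑ n,
      (structureFun (mom x) i j m n : ℂ) * dMom (gen i j) f x * dMom (gen m n) g x := by
    simp only [← Fintype.sum_prod_type' (α₁ := Fin p) (α₂ := Fin p)]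
    exact Finset.sum_comm
  simp only [poisson, h, Finset.sum_neg_distrib, Pi.neg_apply, h', Finset.sum_sub_distrib,
    mul_comm (dMom _ g x) (dRot _ f x), mul_comm (dRot _ g x)]
  ring

theorem poisson_const_left (r : ℂ) (g : Phase p → ℂ) : poisson (fun _ => r) g = 0 := by
  funext x
  simp [poisson, dMom_const, dRot_const]

theorem poisson_add_left {f h : Phase p → ℂ} (hf : HasDerivatives f) (hh : HasDerivatives h)
    (g : Phase p → ℂ) : poisson (f + h) g = poisson f g + poisson h g := by
  funext x
  simp only [poisson, dMom_add hf hh, dRot_add hf hh, Pi.add_apply, mul_add, add_mul,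
    Finset.sum_sub_distrib, Finset.sum_add_distrib]
  ring

/-- Only the factors on the left have to be differentiable: the derivatives of `g` enter as mere
coefficients, whatever value `deriv` gives them. -/
theorem poisson_mul_left {f h : Phase p → ℂ} (hf : HasDerivatives f) (hh : HasDerivatives h)
    (g : Phase p → ℂ) : poisson (f * h) g = h * poisson f g + f * poisson h g := by
  funext x
  have e : ∀ i j m n, (structureFun (mom x) i j m n : ℂ) * (dMom (gen i j) f x * h x
      + f x * dMom (gen i j) h x) * dMom (gen m n) g x =
      h x * ((structureFun (mom x) i j m n : ℂ) * dMom (gen i j) f x * dMom (gen m n) g x)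
      + f x * ((structureFun (mom x) i j m n : ℂ) * dMom (gen i j) h x
        * dMom (gen m n) g x) := fun i j m n => by ring
  have e' : ∀ i j, (dMom (gen i j) f x * h x + f x * dMom (gen i j) h x) * dRot (gen i j) g x
      - (dRot (gen i j) f x * h x + f x * dRot (gen i j) h x) * dMom (gen i j) g x =
      h x * (dMom (gen i j) f x * dRot (gen i j) g x - dRot (gen i j) f x * dMom (gen i j) g x)
      + f x * (dMom (gen i j) h x * dRot (gen i j) g x
        - dRot (gen i j) h x * dMom (gen i j) g x) := fun i j => by ring
  simp only [poisson, dMom_mul hf hh, dRot_mul hf hh, Pi.add_apply, Pi.mul_apply, e, e',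
    Finset.sum_add_distrib, ← Finset.mul_sum]
  ring

theorem hasDerivatives_of_mem_adjoin {s : Set (Phase p → ℂ)} (hs : ∀ f ∈ s, HasDerivatives f)
    {f : Phase p → ℂ} (hf : f ∈ Algebra.adjoin ℂ s) : HasDerivatives f := by
  induction hf using Algebra.adjoin_induction with
  | mem f hf => exact hs f hf
  | algebraMap r => exact hasDerivatives_const r
  | add f g _ _ hf hg => exact hf.add hg
  | mul f g _ _ hf hg => exact hf.mul hg

theorem poisson_eq_zero_of_mem_adjoin_left {s : Set (Phase p → ℂ)}
    (hs : ∀ f ∈ s, HasDerivatives f) {g : Phase p → ℂ} (h : ∀ f ∈ s, poisson f g = 0)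
    {f : Phase p → ℂ} (hf : f ∈ Algebra.adjoin ℂ s) : poisson f g = 0 := by
  induction hf using Algebra.adjoin_induction with
  | mem f hf => exact h f hf
  | algebraMap r => exact poisson_const_left r g
  | add f k hf hk hf' hk' =>
    rw [poisson_add_left (hasDerivatives_of_mem_adjoin hs hf)
      (hasDerivatives_of_mem_adjoin hs hk), hf', hk', add_zero]
  | mul f k hf hk hf' hk' =>
    rw [poisson_mul_left (hasDerivatives_of_mem_adjoin hs hf)
      (hasDerivatives_of_mem_adjoin hs hk), hf', hk', mul_zero, mul_zero, add_zero]

theorem poisson_eq_zero_of_mem_adjoin {s : Set (Phase p → ℂ)}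
    (hs : ∀ f ∈ s, HasDerivatives f) (h : ∀ f ∈ s, ∀ g ∈ s, poisson f g = 0)
    {f g : Phase p → ℂ} (hf : f ∈ Algebra.adjoin ℂ s) (hg : g ∈ Algebra.adjoin ℂ s) :
    poisson f g = 0 := by
  refine poisson_eq_zero_of_mem_adjoin_left hs (fun k hk => ?_) hf
  rw [poisson_swap, poisson_eq_zero_of_mem_adjoin_left hs (fun m hm => h m hm k hk) hg, neg_zero]

end Leibniz

/-! ### Involution of the spectral invariants. -/

section Involution

variable {p q : ℕ}

theorem hasDerivAt_spectral_mom {φ : BlockMatrix p q → ℂ} {G : BlockMatrix p q → BlockMatrix p q}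
    (h : IsSpectralGradient φ G) (c : ℂ) (F : Matrix (Fin p) (Fin q) ℝ) (lam : ℂ)
    (X : LieAlgebra.Orthogonal.so (Fin p) ℝ) (x : Phase p) :
    HasDerivAt (fun t : ℝ => φ (laxKowZ c F lam (x.1, x.2 + t • X)))
      (G (laxKowZ c F lam x) * laxDMom q c lam (cx (X : Matrix (Fin p) (Fin p) ℝ))).trace 0 := by
  have h1 := h.hasDerivAt (fun t : ℝ => laxKowZ c F lam (x.1, x.2 + t • X)) _ 0
    (hasDerivAt_laxKowZ_mom c F lam x X)
  simp only [zero_smul, add_zero] at h1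
  exact h1

theorem hasDerivAt_spectral_rot {φ : BlockMatrix p q → ℂ} {G : BlockMatrix p q → BlockMatrix p q}
    (h : IsSpectralGradient φ G) (c : ℂ) (F : Matrix (Fin p) (Fin q) ℝ) (lam : ℂ)
    (X : LieAlgebra.Orthogonal.so (Fin p) ℝ) (x : Phase p) :
    HasDerivAt (fun t : ℝ => φ (laxKowZ c F lam (x.1 * expSO (t • X), x.2)))
      (G (laxKowZ c F lam x) *
        laxDRot c F lam x (cx (X : Matrix (Fin p) (Fin p) ℝ))).trace 0 := by
  have h1 := h.hasDerivAt (fun t : ℝ => laxKowZ c F lam (x.1 * expSO (t • X), x.2)) _ 0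
    (hasDerivAt_laxKowZ_rot c F lam x X)
  simp only [expSO_zero_smul, mul_one] at h1
  exact h1

theorem hasDerivatives_spectral {φ : BlockMatrix p q → ℂ} {G : BlockMatrix p q → BlockMatrix p q}
    (h : IsSpectralGradient φ G) (c : ℂ) (F : Matrix (Fin p) (Fin q) ℝ) (lam : ℂ) :
    HasDerivatives (fun x => φ (laxKowZ c F lam x)) := fun X x =>
  ⟨(hasDerivAt_spectral_mom h c F lam X x).differentiableAt,
    (hasDerivAt_spectral_rot h c F lam X x).differentiableAt⟩

theorem dMom_spectral {φ : BlockMatrix p q → ℂ} {G : BlockMatrix p q → BlockMatrix p q}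
    (h : IsSpectralGradient φ G) (c : ℂ) (F : Matrix (Fin p) (Fin q) ℝ) (lam : ℂ) (i j : Fin p)
    (x : Phase p) : dMom (gen i j) (fun y => φ (laxKowZ c F lam y)) x =
      (G (laxKowZ c F lam x) * laxDMom q c lam (skewUnit i j)).trace := by
  rw [← cx_gen]
  exact (hasDerivAt_spectral_mom h c F lam (gen i j) x).deriv

theorem dRot_spectral {φ : BlockMatrix p q → ℂ} {G : BlockMatrix p q → BlockMatrix p q}
    (h : IsSpectralGradient φ G) (c : ℂ) (F : Matrix (Fin p) (Fin q) ℝ) (lam : ℂ) (i j : Fin p)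
    (x : Phase p) : dRot (gen i j) (fun y => φ (laxKowZ c F lam y)) x =
      (G (laxKowZ c F lam x) * laxDRot c F lam x (skewUnit i j)).trace := by
  rw [← cx_gen]
  exact (hasDerivAt_spectral_rot h c F lam (gen i j) x).deriv

theorem poisson_spectral {φ ψ : BlockMatrix p q → ℂ} {G H : BlockMatrix p q → BlockMatrix p q}
    (hφ : IsSpectralGradient φ G) (hψ : IsSpectralGradient ψ H) (c : ℂ)
    (F : Matrix (Fin p) (Fin q) ℝ) (lam mu : ℂ) (x : Phase p) :
    poisson (fun y => φ (laxKowZ c F lam y)) (fun y => ψ (laxKowZ c F mu y)) x =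
      (G (laxKowZ c F lam x) * contract (H (laxKowZ c F mu x))
        (tensorBracket (laxKowZ c F lam) (laxKowZ c F mu) x)).trace := by
  rw [tensorBracket_eq_sum _ _ x _ _ _ _ (dMom_laxKowZ c F lam x) (dRot_laxKowZ c F lam x)
    (dMom_laxKowZ c F mu x) (dRot_laxKowZ c F mu x)]
  simp only [map_add, map_smul, map_sum, map_sub, contract_kronecker, Matrix.mul_add,
    Matrix.mul_sub, Matrix.mul_sum, Matrix.mul_smul, Matrix.trace_add, Matrix.trace_sub,
    Matrix.trace_sum, Matrix.trace_smul, smul_eq_mul, Matrix.trace_mul_comm _ (H _), poisson,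
    dMom_spectral hφ, dMom_spectral hψ, dRot_spectral hφ, dRot_spectral hψ]
  congr 2
  · refine Finset.sum_congr rfl fun _ _ => Finset.sum_congr rfl fun _ _ => by ring
  · refine Finset.sum_congr rfl fun _ _ => Finset.sum_congr rfl fun _ _ =>
      Finset.sum_congr rfl fun _ _ => Finset.sum_congr rfl fun _ _ => by ring

/-- Contraction with `H`, which commutes with `L(μ)`, kills `[r₂₁, L₂]`; the trace against `G`,
which commutes with `L(λ)`, kills `[r₁₂, L₁]`. -/
theorem poisson_spectral_eq_zero_of_ne (hqp : q ≤ p) {φ ψ : BlockMatrix p q → ℂ}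
    {G H : BlockMatrix p q → BlockMatrix p q}
    (hφ : IsSpectralGradient φ G) (hψ : IsSpectralGradient ψ H) (c : ℂ)
    (F : Matrix (Fin p) (Fin q) ℝ) {lam mu : ℂ} (hlam : lam ∈ domainKowZ p q c)
    (hmu : mu ∈ domainKowZ p q c) (hne : lam ^ 2 ≠ mu ^ 2) (x : Phase p) :
    poisson (fun y => φ (laxKowZ c F lam y)) (fun y => ψ (laxKowZ c F mu y)) x = 0 := by
  rw [poisson_spectral hφ hψ, rMatrixRelation_laxKowZ hqp F c lam mu hlam hmu hne x,
    Ring.lie_def, Ring.lie_def, map_neg, map_sub, map_sub, map_sub, contract_mul_fst,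
    contract_fst_mul, contract_mul_snd, contract_snd_mul, hψ.commute, sub_self, sub_zero,
    Matrix.mul_neg, Matrix.mul_sub, Matrix.trace_neg, Matrix.trace_sub, ← Matrix.mul_assoc,
    ← Matrix.mul_assoc, Matrix.trace_mul_comm _ (laxKowZ c F lam x), ← Matrix.mul_assoc,
    hφ.commute, sub_self, neg_zero]

theorem continuous_dress (c : ℂ) : Continuous (dress p q c) :=
  continuous_const.sub (continuous_id.smul continuous_const)

theorem continuousAt_dress_inv {c mu : ℂ} (hmu : mu ∈ domainKowZ p q c) :
    ContinuousAt (fun z => (dress p q c z)⁻¹) mu := by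
  simp only [Matrix.inv_def, Ring.inverse_eq_inv']
  exact ((continuous_dress c).matrix_det.continuousAt.inv₀ hmu.2).smul
    (continuous_dress c).matrix_adjugate.continuousAt

theorem continuousAt_laxKowZ {c mu : ℂ} (F : Matrix (Fin p) (Fin q) ℝ)
    (hmu : mu ∈ domainKowZ p q c) (x : Phase p) :
    ContinuousAt (fun z => laxKowZ c F z x) mu := by
  simp only [laxKowZ_eq, laxNum]
  exact (continuousAt_dress_inv hmu).mul ((((continuousAt_id.smul continuousAt_const).sub
    continuousAt_const).add ((continuousAt_inv₀ hmu.1).smul continuousAt_const)).sub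
    continuousAt_const)

theorem continuousAt_laxDMom {c mu : ℂ} (hmu : mu ∈ domainKowZ p q c)
    (X : Matrix (Fin p) (Fin p) ℂ) : ContinuousAt (fun z => laxDMom q c z X) mu :=
  (continuousAt_dress_inv hmu).mul continuousAt_const

theorem continuousAt_laxDRot {c mu : ℂ} (F : Matrix (Fin p) (Fin q) ℝ)
    (hmu : mu ∈ domainKowZ p q c) (x : Phase p) (X : Matrix (Fin p) (Fin p) ℂ) :
    ContinuousAt (fun z => laxDRot c F z x X) mu :=
  (continuousAt_dress_inv hmu).mul (((continuousAt_inv₀ hmu.1).smul continuousAt_const).sub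
    continuousAt_const)

theorem continuousAt_poisson_spectral {ψ : BlockMatrix p q → ℂ}
    {H : BlockMatrix p q → BlockMatrix p q} (hψ : IsSpectralGradient ψ H) {c mu : ℂ}
    (F : Matrix (Fin p) (Fin q) ℝ) (hmu : mu ∈ domainKowZ p q c) (f : Phase p → ℂ)
    (x : Phase p) : ContinuousAt (fun z => poisson f (fun y => ψ (laxKowZ c F z y)) x) mu := by
  have htr : Continuous (Matrix.trace : BlockMatrix p q → ℂ) := continuous_id.matrix_trace
  have hH : ContinuousAt (fun z => H (laxKowZ c F z x)) mu :=
    hψ.continuous.continuousAt.comp (continuousAt_laxKowZ F hmu x)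
  have hM : ∀ i j, ContinuousAt
      (fun z => dMom (gen i j) (fun y => ψ (laxKowZ c F z y)) x) mu := fun i j => by
    simp only [dMom_spectral hψ]
    exact htr.continuousAt.comp (hH.mul (continuousAt_laxDMom hmu _))
  have hR : ∀ i j, ContinuousAt
      (fun z => dRot (gen i j) (fun y => ψ (laxKowZ c F z y)) x) mu := fun i j => by
    simp only [dRot_spectral hψ]
    exact htr.continuousAt.comp (hH.mul (continuousAt_laxDRot F hmu x _))
  unfold poisson
  refine (continuousAt_const.mul ?_).add (continuousAt_const.mul ?_)
  · exact tendsto_finsetSum _ fun i _ => tendsto_finsetSum _ fun j _ =>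
      (continuousAt_const.mul (hR i j)).sub (continuousAt_const.mul (hM i j))
  · exact tendsto_finsetSum _ fun i _ => tendsto_finsetSum _ fun j _ =>
      tendsto_finsetSum _ fun m _ => tendsto_finsetSum _ fun n _ =>
        continuousAt_const.mul (hM m n)

/-- The kernel is singular at `λ² = μ²`, but the bracket is continuous in `μ`. It vanishes at all
admissible `z` near `μ` other than `μ`, `λ` and `-λ`, hence also at `μ`. -/
theorem poisson_spectral_eq_zero (hqp : q ≤ p) {φ ψ : BlockMatrix p q → ℂ}
    {G H : BlockMatrix p q → BlockMatrix p q}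
    (hφ : IsSpectralGradient φ G) (hψ : IsSpectralGradient ψ H) (c : ℂ)
    (F : Matrix (Fin p) (Fin q) ℝ) {lam mu : ℂ} (hlam : lam ∈ domainKowZ p q c)
    (hmu : mu ∈ domainKowZ p q c) :
    poisson (fun y => φ (laxKowZ c F lam y)) (fun y => ψ (laxKowZ c F mu y)) = 0 := by
  funext x
  have h1 := (continuousAt_poisson_spectral hψ F hmu
    (fun y => φ (laxKowZ c F lam y)) x).tendsto.mono_left
    (nhdsWithin_le_nhds (s := {mu}ᶜ))
  have hne : ∀ a : ℂ, ∀ᶠ z in nhdsWithin mu {mu}ᶜ, z ≠ a := by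
    intro a
    by_cases ha : mu = a
    · rw [← ha]
      exact self_mem_nhdsWithin
    · exact (eventually_ne_nhds ha).filter_mono nhdsWithin_le_nhds
  have hD : ∀ᶠ z in nhdsWithin mu {mu}ᶜ, z ∈ domainKowZ p q c :=
    ((eventually_ne_nhds hmu.1).and ((continuous_dress c).matrix_det.continuousAt.eventually_ne
      hmu.2)).filter_mono nhdsWithin_le_nhds
  have h2 : ∀ᶠ z in nhdsWithin mu {mu}ᶜ,
      poisson (fun y => φ (laxKowZ c F lam y)) (fun y => ψ (laxKowZ c F z y)) x = 0 := by
    filter_upwards [hne lam, hne (-lam), hD] with z hz1 hz2 hz3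
    refine poisson_spectral_eq_zero_of_ne hqp hφ hψ c F hlam hz3 (fun e => ?_) x
    rcases sq_eq_sq_iff_eq_or_eq_neg.1 e.symm with e | e
    exacts [hz1 e, hz2 e]
  exact tendsto_nhds_unique h1 (tendsto_const_nhds.congr' (h2.mono fun _ h => h.symm))

theorem poisson_spectralInvariants (hqp : q ≤ p) (c : ℂ) (F : Matrix (Fin p) (Fin q) ℝ)
    {f g : Phase p → ℂ} (hf : f ∈ spectralInvariants (laxKowZ c F) (domainKowZ p q c))
    (hg : g ∈ spectralInvariants (laxKowZ c F) (domainKowZ p q c)) : poisson f g = 0 := by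
  have key : ∀ f ∈ ({f | ∃ lam ∈ domainKowZ p q c, ∃ n : ℕ,
      f = fun x => (laxKowZ c F lam x).charpoly.coeff n} ∪
      {f | ∃ lam ∈ domainKowZ p q c, ∃ n : ℕ, f = fun x => ((laxKowZ c F lam x) ^ n).trace} :
        Set (Phase p → ℂ)), ∃ lam ∈ domainKowZ p q c, ∃ φ G, IsSpectralGradient φ G ∧
        f = fun x => φ (laxKowZ c F lam x) := by
    rintro f (⟨lam, hlam, n, rfl⟩ | ⟨lam, hlam, n, rfl⟩)
    · obtain ⟨G, hG⟩ := exists_isSpectralGradient_charpoly_coeff (N := Fin p ⊕ Fin q) n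
      exact ⟨lam, hlam, _, G, hG, rfl⟩
    · exact ⟨lam, hlam, _, _, isSpectralGradient_trace_pow n, rfl⟩
  refine poisson_eq_zero_of_mem_adjoin (fun f hf => ?_) (fun f hf g hg => ?_) hf hg
  · obtain ⟨lam, -, φ, G, h, rfl⟩ := key f hf
    exact hasDerivatives_spectral h c F lam
  · obtain ⟨lam, hlam, φ, G, h, rfl⟩ := key f hf
    obtain ⟨mu, hmu, ψ, H, h', rfl⟩ := key g hg
    exact poisson_spectral_eq_zero hqp h h' c F hlam hmu

end Involution
end KowalevskiTop

end

theorem mainTheorem6 (p q : ℕ) (hqp : q ≤ p) (F : Matrix (Fin p) (Fin q) ℝ) (c : ℂ) :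
    (∀ f ∈ KowalevskiTop.spectralInvariants (KowalevskiTop.laxKow F) KowalevskiTop.domainKow,
      ∀ g ∈ KowalevskiTop.spectralInvariants (KowalevskiTop.laxKow F) KowalevskiTop.domainKow,
        KowalevskiTop.poisson f g = 0) ∧
    (∀ f ∈ KowalevskiTop.spectralInvariants (KowalevskiTop.laxKowZ c F)
        (KowalevskiTop.domainKowZ p q c),
      ∀ g ∈ KowalevskiTop.spectralInvariants (KowalevskiTop.laxKowZ c F)
        (KowalevskiTop.domainKowZ p q c),
        KowalevskiTop.poisson f g = 0) ∧
    (∀ lam ∈ KowalevskiTop.domainKow, ∀ mu ∈ KowalevskiTop.domainKow, lam ^ 2 ≠ mu ^ 2 →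
      KowalevskiTop.RMatrixRelation (KowalevskiTop.laxKow F) KowalevskiTop.rKow lam mu) ∧
    (∀ lam ∈ KowalevskiTop.domainKowZ p q c, ∀ mu ∈ KowalevskiTop.domainKowZ p q c,
      lam ^ 2 ≠ mu ^ 2 →
      KowalevskiTop.RMatrixRelation (KowalevskiTop.laxKowZ c F) (KowalevskiTop.rKowZ c)
        lam mu) := by
  refine ⟨fun f hf g hg => ?_, fun f hf g hg =>
    KowalevskiTop.poisson_spectralInvariants hqp c F hf hg, fun lam hlam mu hmu hne => ?_,
    fun lam hlam mu hmu hne =>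
      KowalevskiTop.rMatrixRelation_laxKowZ hqp F c lam mu hlam hmu hne⟩
  -- At `c = 0` one has `z̃ = 0`, so the perturbed Lax matrix and its domain are the unperturbed
  -- ones.
  · rw [← KowalevskiTop.laxKowZ_zero, ← KowalevskiTop.domainKowZ_zero (p := p) (q := q)] at hf hg
    exact KowalevskiTop.poisson_spectralInvariants hqp 0 F hf hg
  · rw [← KowalevskiTop.domainKowZ_zero (p := p) (q := q)] at hlam hmu
    have h := KowalevskiTop.rMatrixRelation_laxKowZ hqp F 0 lam mu hlam hmu hne
    rw [KowalevskiTop.laxKowZ_zero] at h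
    intro x
    rw [h x, KowalevskiTop.flipKernel, KowalevskiTop.flipKernel, KowalevskiTop.rKowZ_zero,
      KowalevskiTop.rKowZ_zero]
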